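/- **Definitions.** Let $\theta>0$ and let $\nu$ be a $\sigma$-finite measure on $[0,\infty)$ with $\int\log(1+\lambda x)\,\nu(dx)<\infty$ for all $\lambda>0$. A positive infinitely divisible random variable $L$ is GGC$(\theta,\nu)$ (a generalized gamma convolution) if $\mathbb E[e^{-\lambda L}]=\exp\big(-\theta\int\log(1+\lambda x)\,\nu(dx)\big)$ for all $\lambda>0$. For $b,c>0$, its exponential tilt, with law denoted GGC$^{(b,c)}(\theta,\nu)$, is the random variable whose law is that of $bL$ weighted by $e^{-(c/b)w}$ and normalized, i.e. with density proportional to $e^{-(c/b)w}b^{-1}f_L(w/b)$ if $L$ has density $f_L$. For a probability measure $H$ on $[0,\infty)$, the Dirichlet mean functional is $M_\theta(H)=\int x\,P(dx)$, where $P$ is a Dirichlet process with shape parameter $\theta H$, that is, $P=\sum_{k\ge 0} P_k\delta_{Z_k}$ with $P_k=V_k\prod_{j<k}(1-V_j)$, where the $V_k$ are i.i.d. Beta$(1,\theta)$, the $Z_k$ are i.i.d. with law $H$, and the two sequences are independent. Put $e^{-s/0}:=0$ for $s>0$. **Proposition 3.2.** Let $\theta,c>0$, let $H$ be a probability measure on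 $[0,\infty)$, let $L$ be GGC$(\theta,H)$, let $X$ have distribution $H$, put $A_c^*=cX/(cX+1)$, and let $Q_c$ be the distribution of $A_c^*$. Then $A_c^*\in[0,1]$ almost surely, and the exponential tilt $L_c$ of $L$ with law GGC$^{(c,c)}(\theta,H)$ is GGC$(\theta,Q_c)$. Moreover, for all $s>0$, $$\int_{(0,\infty)}e^{-s\frac{cr+1}{cr}}\,H(dr)=\int_{(0,\infty)}e^{-s/y}\,Q_c(dy),$$ and $L_c$ has zero drift and Lévy measure $\theta s^{-1}\,\mathbb E[e^{-s/A_c^*}]\,ds$ on $(0,\infty)$; that is, this measure integrates $\min(1,s)$ and $\mathbb E[e^{-\lambda L_c}]=\exp\big(-\int_0^\infty(1-e^{-\lambda s})\,\theta s^{-1}\,\mathbb E[e^{-s/A_c^*}]\,ds\big)$ for all $\lambda>0$. The integrals $\int x\,P(dx)$ defining $M_\theta(H)$ and $M_\theta(Q_c)$ converge absolutely almost surely, and the following hold. (i) If $M_\theta(H)$ has a density $f_{M_\theta}(\cdot|H)$, then $M_\theta(Q_c)$ has a density, given by $$f_{M_\theta}(y|Q_c)=\frac{(1-y)^{\theta-2}}{c\,\mathbb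 E[(1+cM_\theta(H))^{-\theta}]}\;f_{M_\theta}\Big(\frac{y}{c(1-y)}\Big|H\Big),\qquad 0<y<1,$$ and equal to $0$ outside $(0,1)$. (ii) Conversely, if $M_\theta(Q_c)$ has a density $f_{M_\theta}(\cdot|Q_c)$, then $M_\theta(H)$ has a density, given by $$f_{M_\theta}(x|H)=c\,(1+cx)^{\theta-2}\,f_{M_\theta}\Big(\frac{cx}{1+cx}\Big|Q_c\Big)\,\mathbb E[(1+cM_\theta(H))^{-\theta}],\qquad x>0,$$ and equal to $0$ for $x\le 0$. In particular, if $M_\theta(Q_1)$ has a density, then $M_\theta(H)$ has the density $$f_{M_\theta}(x|H)=(1+x)^{\theta-2}\,f_{M_\theta}\Big(\frac{x}{1+x}\Big|Q_1\Big)\,\mathbb E[(1+M_\theta(H))^{-\theta}],\qquad x>0.$$ -/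

import Mathlib

open MeasureTheory ProbabilityTheory Set

noncomputable section

/-- Infinite divisibility: for every `n ≥ 1` the law `μ` is the law of the sum of `n` independent
random variables with a common law `ρ`. -/
def InfDivisible (μ : Measure ℝ) : Prop :=
  ∀ n : ℕ, 0 < n → ∃ ρ : Measure ℝ, IsProbabilityMeasure ρ ∧
    (Measure.pi fun _ : Fin n => ρ).map (fun x => ∑ i, x i) = μ

/-- `μ` is the law of a GGC`(θ, ν)` random variable (a generalized gamma convolution): a positive
infinitely divisible random variable with Laplace transform `exp (-θ ∫ log (1 + l x) ν(dx))`, where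
the Thorin measure `ν` is a σ-finite measure on `[0, ∞)` with a finite integral in the exponent.
(An atom of `ν` at `0` is allowed; it does not contribute to the integral.) -/
structure IsGGC (θ : ℝ) (ν μ : Measure ℝ) : Prop where
  isProbabilityMeasure : IsProbabilityMeasure μ
  pos : μ (Iic 0) = 0
  infDivisible : InfDivisible μ
  sigmaFinite : SigmaFinite ν
  thorin_nonneg : ν (Iio 0) = 0
  integrable_log : ∀ l : ℝ, 0 < l → Integrable (fun x => Real.log (1 + l * x)) ν
  laplace : ∀ l : ℝ, 0 < l →
    ∫ x, Real.exp (-l * x) ∂μ = Real.exp (-θ * ∫ x, Real.log (1 + l * x) ∂ν)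

/-- The exponential tilt GGC`^(b,c)`: the law of `b L` weighted by `w ↦ exp (-(c / b) w)` and
normalized. If `L ~ μ` has density `f`, this law has density proportional to
`w ↦ exp (-(c / b) w) b⁻¹ f (w / b)`. -/
def expTilt (b c : ℝ) (μ : Measure ℝ) : Measure ℝ :=
  (μ.map (fun x => b * x)).tilted (fun w => -(c / b) * w)

/-- The law `Q_c` of `c X / (c X + 1)` for `X ~ H`. -/
def ratioLaw (c : ℝ) (H : Measure ℝ) : Measure ℝ :=
  H.map (fun x => c * x / (c * x + 1))

/-- Lévy-Khintchine representation of a law `μ` on `[0, ∞)`: drift `d` and Lévy measure `Λ`. -/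
structure HasDriftLevyMeasure (μ : Measure ℝ) (d : ℝ) (Λ : Measure ℝ) : Prop where
  drift_nonneg : 0 ≤ d
  levy_nonpos : Λ (Iic 0) = 0
  levy_min : ∫⁻ s, ENNReal.ofReal (min 1 s) ∂Λ < ⊤
  laplace : ∀ l : ℝ, 0 < l →
    ∫ x, Real.exp (-l * x) ∂μ =
      Real.exp (-(d * l + ∫ s, (1 - Real.exp (-l * s)) ∂Λ))

/-- `exp (-s / a)` for `a > 0`, with its limiting value `0` at `a = 0` (for `s > 0`). -/
def expNegDiv (s a : ℝ) : ℝ := if 0 < a then Real.exp (-s / a) else 0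

/-- The stick-breaking weights `V_k ∏_{j < k} (1 - V_j)`. -/
def stickWeight (v : ℕ → ℝ) (k : ℕ) : ℝ := v k * ∏ j ∈ Finset.range k, (1 - v j)

/-- The random measure `∑_k P_k δ_{Z_k}` with stick-breaking weights `P_k`, as a function of the
sequence `ω` of pairs `(V_k, Z_k)`. -/
def randomAtoms (ω : ℕ → ℝ × ℝ) : Measure ℝ :=
  Measure.sum fun k =>
    ENNReal.ofReal (stickWeight (fun j => (ω j).1) k) • Measure.dirac (ω k).2

/-- The joint law of an i.i.d. sequence of pairs `(V_k, Z_k)`, with `V_k ~ Beta(1, θ)` and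
`Z_k ~ H` independent. Under this law `randomAtoms` is the Dirichlet process with shape parameter
`θ H`: its weights are the Poisson-Dirichlet`(0, θ)` frequencies, in size-biased order, and its atoms
are i.i.d. `H` and independent of the weights. -/
def dirichletBase (θ : ℝ) (H : Measure ℝ) : Measure (ℕ → ℝ × ℝ) :=
  Measure.infinitePi fun _ : ℕ => (betaMeasure 1 θ).prod H

/-- The law of the Dirichlet mean functional `M_θ(H) = ∫ x P(dx)`, where `P` is a Dirichlet process
with shape parameter `θ H`. -/
def dirichletMeanLaw (θ : ℝ) (H : Measure ℝ) : Measure ℝ :=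
  (dirichletBase θ H).map (fun ω => ∫ x, x ∂(randomAtoms ω))

/-- The quantity `E[(1 + c M_θ(H))^(-θ)]`. -/
def stieltjesMean (θ c : ℝ) (H : Measure ℝ) : ℝ :=
  ∫ m, (1 + c * m) ^ (-θ) ∂(dirichletMeanLaw θ H)

/-- `f` is a density of the law `μ` with respect to Lebesgue measure. -/
structure HasDensity (μ : Measure ℝ) (f : ℝ → ℝ) : Prop where
  measurable : Measurable f
  nonneg : ∀ x, 0 ≤ f x
  eq_withDensity : μ = volume.withDensity (fun x => ENNReal.ofReal (f x))

end

/-! Everything is read off from transforms. The identity 1 + z·cx/(cx+1) = (1 + (1+z)cx)/(1 + cx)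
turns ∫ log(1+zy) Q_c(dy) into ∫ log(1+(1+z)cx) H(dx) - ∫ log(1+cx) H(dx) (`integral_log_ratioLaw`).
The Laplace transform of the tilt at l is that of L at (1+l)c divided by that at c, so its exponent
is -θ times this difference, and the Thorin measure of the tilt is Q_c. The Lévy measure then comes
from writing log(1+ly) as a Frullani integral and integrating over y.

For the means, the key is the Markov-Krein identity E[(1+zM)^(-θ)] = exp(-θ ∫ log(1+zx) H(dx))
(`stieltjes_dirichletMeanLaw`). Stick-breaking gives M = VZ + (1-V)M' in law. Averaging over V ~
Beta(1, θ) by Feynman's formula shows that the transform of exponent θ+1 is the transform of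
exponent θ times ∫ (1+zx)⁻¹ H(dx); this amounts to a first-order linear differential equation in z,
with value 1 at 0+.

Apply the identity to H and to Q_c. It shows that the law of M_θ(Q_c) has the same generalized
Stieltjes transform as the image under m ↦ cm/(cm+1) of the law of M_θ(H) weighted by (1+cm)^(-θ).
Both live on [0, 1], where this transform determines the law (`ext_of_stieltjes`), so they agree
(`dirichletMeanLaw_ratioLaw`). Both density formulas are changes of variables in this equality. -/

/-! ### Uniqueness theorems: moments, Laplace and Stieltjes transforms. -/

/-- Finite measures on `[0, 1]` with equal moments are equal. -/
lemma ext_of_moments {μ ν : Measure ℝ} [IsFiniteMeasure μ] [IsFiniteMeasure ν]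
    (hμ : ∀ᵐ x ∂μ, x ∈ Icc (0 : ℝ) 1) (hν : ∀ᵐ x ∂ν, x ∈ Icc (0 : ℝ) 1)
    (h : ∀ n : ℕ, ∫ x, x ^ n ∂μ = ∫ x, x ^ n ∂ν) : μ = ν := by
  have hint : ∀ (ρ : Measure ℝ) [IsFiniteMeasure ρ], (∀ᵐ x ∂ρ, x ∈ Icc (0 : ℝ) 1) →
      ∀ n : ℕ, Integrable (fun x : ℝ => x ^ n) ρ := by
    intro ρ _ hρ n
    refine Integrable.of_bound (by fun_prop) 1 ?_
    filter_upwards [hρ] with x hx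
    rw [Real.norm_eq_abs, abs_of_nonneg (pow_nonneg hx.1 n)]
    exact pow_le_one₀ hx.1 hx.2
  have hpoly : ∀ p : Polynomial ℝ, ∫ x, p.eval x ∂μ = ∫ x, p.eval x ∂ν := by
    intro p
    simp_rw [Polynomial.eval_eq_sum_range]
    rw [integral_finsetSum _ fun n _ => (hint μ hμ n).const_mul _,
      integral_finsetSum _ fun n _ => (hint ν hν n).const_mul _]
    simp_rw [integral_const_mul, h]
  have hpint : ∀ (ρ : Measure ℝ) [IsFiniteMeasure ρ], (∀ᵐ x ∂ρ, x ∈ Icc (0 : ℝ) 1) →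
      ∀ p : Polynomial ℝ, Integrable (fun x : ℝ => p.eval x) ρ := by
    intro ρ _ hρ p
    simp_rw [Polynomial.eval_eq_sum_range]
    exact integrable_finsetSum _ fun n _ => (hint ρ hρ n).const_mul _
  refine ext_of_forall_integral_eq_of_IsFiniteMeasure fun f => ?_
  refine eq_of_forall_dist_le fun ε hε => ?_
  -- The summand 1 keeps K positive even when both measures vanish.
  set K : ℝ := μ.real univ + ν.real univ + 1 with hK
  have hKpos : 0 < K := by positivity
  obtain ⟨p, hp⟩ := exists_polynomial_near_of_continuousOn 0 1 f f.continuous.continuousOn (ε / K)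
    (div_pos hε hKpos)
  have key : ∀ (ρ : Measure ℝ) [IsFiniteMeasure ρ], (∀ᵐ x ∂ρ, x ∈ Icc (0 : ℝ) 1) →
      |∫ x, f x ∂ρ - ∫ x, p.eval x ∂ρ| ≤ ε / K * ρ.real univ := by
    intro ρ _ hρ
    rw [← integral_sub (f.integrable ρ) (hpint ρ hρ p), ← Real.norm_eq_abs]
    refine norm_integral_le_of_norm_le_const ?_
    filter_upwards [hρ] with x hx
    rw [Real.norm_eq_abs, abs_sub_comm]
    exact (hp x hx).le
  rw [Real.dist_eq]
  have h1 := key μ hμ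
  have h2 := key ν hν
  rw [hpoly] at h1
  calc |∫ x, f x ∂μ - ∫ x, f x ∂ν|
      ≤ |∫ x, f x ∂μ - ∫ x, p.eval x ∂ν| + |∫ x, f x ∂ν - ∫ x, p.eval x ∂ν| := by
        rw [abs_sub_comm (∫ x, f x ∂ν)]; exact abs_sub_le _ _ _
    _ ≤ ε / K * μ.real univ + ε / K * ν.real univ := add_le_add h1 h2
    _ ≤ ε / K * K := by
        rw [← mul_add]
        exact mul_le_mul_of_nonneg_left (by linarith) (by positivity)
    _ = ε := by field_simp

/-- Laplace transforms characterize probability measures on `[0, ∞)`. -/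
lemma ext_of_laplace {μ ν : Measure ℝ} [IsProbabilityMeasure μ] [IsProbabilityMeasure ν]
    (hμ : ∀ᵐ x ∂μ, 0 ≤ x) (hν : ∀ᵐ x ∂ν, 0 ≤ x)
    (h : ∀ l : ℝ, 0 < l → ∫ x, Real.exp (-l * x) ∂μ = ∫ x, Real.exp (-l * x) ∂ν) : μ = ν := by
  -- Under x ↦ exp(-x), with left inverse -log, the half-line goes into [0, 1] and the Laplace
  -- transform at the integer n becomes the n-th moment.
  have hm : Measurable fun x : ℝ => Real.exp (-x) := by fun_prop
  have hlog : ∀ ρ : Measure ℝ, (ρ.map fun x : ℝ => Real.exp (-x)).map (fun y => -Real.log y) = ρ := by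
    intro ρ
    rw [Measure.map_map (by fun_prop) hm]
    convert Measure.map_id using 2
    ext x; simp
  have : IsProbabilityMeasure (μ.map fun x : ℝ => Real.exp (-x)) :=
    Measure.isProbabilityMeasure_map hm.aemeasurable
  have : IsProbabilityMeasure (ν.map fun x : ℝ => Real.exp (-x)) :=
    Measure.isProbabilityMeasure_map hm.aemeasurable
  have key : (μ.map fun x : ℝ => Real.exp (-x)) = ν.map fun x : ℝ => Real.exp (-x) := by
    refine ext_of_moments ?_ ?_ fun n => ?_
    · refine (ae_map_iff hm.aemeasurable measurableSet_Icc).2 ?_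
      filter_upwards [hμ] with x hx
      exact ⟨(Real.exp_pos _).le, by simpa using hx⟩
    · refine (ae_map_iff hm.aemeasurable measurableSet_Icc).2 ?_
      filter_upwards [hν] with x hx
      exact ⟨(Real.exp_pos _).le, by simpa using hx⟩
    · rw [integral_map hm.aemeasurable (by fun_prop), integral_map hm.aemeasurable (by fun_prop)]
      rcases Nat.eq_zero_or_pos n with rfl | hn
      · simp
      · simp_rw [← Real.exp_nat_mul, mul_neg, ← neg_mul]
        exact h n (by exact_mod_cast hn)
  rw [← hlog μ, key, hlog]

lemma gammaMeasure_ae_nonneg (θ r : ℝ) : ∀ᵐ x ∂(gammaMeasure θ r), 0 ≤ x := by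
  simp only [ae_iff, not_le, gammaMeasure]
  refine (withDensity_apply _ measurableSet_Iio).trans ?_
  exact setLIntegral_eq_zero measurableSet_Iio fun x hx => gammaPDF_of_neg hx

/-- Used at two extremes: n = 0 is the Laplace transform of the gamma law, z = 0 gives its moments.
-/
lemma integral_pow_mul_exp_gammaMeasure {θ : ℝ} (hθ : 0 < θ) {z : ℝ} (hz : -1 < z) (n : ℕ) :
    ∫ x, x ^ n * Real.exp (-z * x) ∂(gammaMeasure θ 1) =
      Real.Gamma (θ + n) / Real.Gamma θ * (1 + z) ^ (-(θ + n)) := by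
  have hpos : 0 < 1 + z := by linarith
  rw [gammaMeasure, integral_withDensity_eq_integral_toReal_smul
    (by unfold gammaPDF; exact (measurable_gammaPDFReal θ 1).ennreal_ofReal)
    (by simp [gammaPDF])]
  have h1 : ∀ x : ℝ, x ≠ 0 → (gammaPDF θ 1 x).toReal • (x ^ n * Real.exp (-z * x)) =
      (Ioi (0 : ℝ)).indicator (fun x => (Real.Gamma θ)⁻¹ *
        (x ^ (θ + n - 1) * Real.exp (-((1 + z) * x)))) x := by
    intro x hx
    rw [gammaPDF, ENNReal.toReal_ofReal (gammaPDFReal_nonneg hθ one_pos x), gammaPDFReal]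
    rcases lt_or_gt_of_ne hx with h | h
    · rw [if_neg (not_le.2 h), indicator_of_notMem (by simpa using h.le)]; simp
    · rw [if_pos h.le, indicator_of_mem (by simpa using h), Real.one_rpow, smul_eq_mul,
        show θ + n - 1 = (θ - 1) + n by ring, Real.rpow_add h, Real.rpow_natCast,
        show -((1 + z) * x) = -(1 * x) + -z * x by ring, Real.exp_add]
      ring
  -- The origin is discarded: the gamma density is supported on the closed half-line, the indicator
  -- on the open one.
  have h0 : ∀ᵐ x : ℝ, x ≠ 0 := by simp [ae_iff]
  rw [integral_congr_ae (h0.mono h1), integral_indicator measurableSet_Ioi, integral_const_mul,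
    Real.integral_rpow_mul_exp_neg_mul_Ioi (by positivity) hpos, one_div,
    Real.inv_rpow hpos.le, Real.rpow_neg hpos.le]
  ring

/-- Generalized Stieltjes transforms characterize probability measures on `[0, 1]`. -/
lemma ext_of_stieltjes {θ : ℝ} (hθ : 0 < θ) {μ ν : Measure ℝ} [IsProbabilityMeasure μ]
    [IsProbabilityMeasure ν]
    (hμ : ∀ᵐ x ∂μ, x ∈ Icc (0 : ℝ) 1) (hν : ∀ᵐ x ∂ν, x ∈ Icc (0 : ℝ) 1)
    (h : ∀ z : ℝ, 0 < z → ∫ m, (1 + z * m) ^ (-θ) ∂μ = ∫ m, (1 + z * m) ^ (-θ) ∂ν) : μ = ν := by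
  have := isProbabilityMeasure_gammaMeasure hθ one_pos
  -- Randomization: for an independent gamma variable G, the Laplace transform of Gm is the
  -- Stieltjes transform of m. Hence Gm has the same law in both cases, and dividing its moments by
  -- the nonzero moments of G gives those of m.
  set γ := gammaMeasure θ 1
  have hm : Measurable fun p : ℝ × ℝ => p.1 * p.2 := by fun_prop
  have hnn : ∀ (ρ : Measure ℝ) [IsProbabilityMeasure ρ], (∀ᵐ x ∂ρ, x ∈ Icc (0 : ℝ) 1) →
      ∀ᵐ p ∂(γ.prod ρ), 0 ≤ p.1 * p.2 := by
    intro ρ _ hρ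
    filter_upwards [Measure.quasiMeasurePreserving_fst.ae (gammaMeasure_ae_nonneg θ 1),
      Measure.quasiMeasurePreserving_snd.ae hρ] with p h1 h2
    exact mul_nonneg h1 h2.1
  have hlap : ∀ (ρ : Measure ℝ) [IsProbabilityMeasure ρ], (∀ᵐ x ∂ρ, x ∈ Icc (0 : ℝ) 1) →
      ∀ l : ℝ, 0 < l → ∫ x, Real.exp (-l * x) ∂((γ.prod ρ).map fun p => p.1 * p.2) =
        ∫ m, (1 + l * m) ^ (-θ) ∂ρ := by
    intro ρ _ hρ l hl
    rw [integral_map hm.aemeasurable (by fun_prop), integral_prod_symm]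
    · refine integral_congr_ae ?_
      filter_upwards [hρ] with m hm
      have := integral_pow_mul_exp_gammaMeasure hθ (z := l * m) (by nlinarith [hm.1]) 0
      simp only [pow_zero, one_mul, Nat.cast_zero, add_zero,
        div_self (Real.Gamma_pos_of_pos hθ).ne'] at this
      rw [← this]
      congr! 3
      ring
    · refine Integrable.of_bound (by fun_prop) 1 ?_
      filter_upwards [hnn ρ hρ] with p hp
      rw [Real.norm_eq_abs, abs_of_pos (Real.exp_pos _), Real.exp_le_one_iff]
      nlinarith
  have := Measure.isProbabilityMeasure_map (μ := γ.prod μ) hm.aemeasurable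
  have := Measure.isProbabilityMeasure_map (μ := γ.prod ν) hm.aemeasurable
  have key : (γ.prod μ).map (fun p => p.1 * p.2) = (γ.prod ν).map fun p => p.1 * p.2 := by
    refine ext_of_laplace ?_ ?_ fun l hl => ?_
    · rw [ae_map_iff hm.aemeasurable measurableSet_Ici]; exact hnn μ hμ
    · rw [ae_map_iff hm.aemeasurable measurableSet_Ici]; exact hnn ν hν
    · rw [hlap μ hμ l hl, hlap ν hν l hl, h l hl]
  have hmom : ∀ (ρ : Measure ℝ) [IsProbabilityMeasure ρ] (n : ℕ),
      ∫ x, x ^ n ∂((γ.prod ρ).map fun p => p.1 * p.2) =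
        Real.Gamma (θ + n) / Real.Gamma θ * ∫ m, m ^ n ∂ρ := by
    intro ρ _ n
    rw [integral_map hm.aemeasurable (by fun_prop)]
    simp_rw [mul_pow]
    rw [integral_prod_mul (fun x : ℝ => x ^ n) (fun x : ℝ => x ^ n)]
    have := integral_pow_mul_exp_gammaMeasure hθ (z := 0) (by norm_num) n
    simp only [neg_zero, zero_mul, Real.exp_zero, mul_one, add_zero, Real.one_rpow] at this
    rw [this]
  refine ext_of_moments hμ hν fun n => ?_
  have h1 := hmom μ n
  rw [key, hmom ν n] at h1
  have hne : Real.Gamma (θ + n) / Real.Gamma θ ≠ 0 :=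
    (div_pos (Real.Gamma_pos_of_pos (by positivity)) (Real.Gamma_pos_of_pos hθ)).ne'
  exact (mul_left_cancel₀ hne h1).symm

/-! ### Head and tail of an i.i.d. sequence. -/

/-- The sequence with first term `a` and tail `w`. -/
def seqCons {α : Type*} (a : α) (w : ℕ → α) : ℕ → α
  | 0 => a
  | n + 1 => w n

lemma measurable_seqCons {α : Type*} [MeasurableSpace α] :
    Measurable fun p : α × (ℕ → α) => seqCons p.1 p.2 := by
  refine measurable_pi_lambda _ fun n => ?_
  cases n with
  | zero => exact measurable_fst
  | succ n => exact (measurable_pi_apply n).comp measurable_snd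

/-- The head and the tail of an i.i.d. sequence are independent. -/
lemma map_seqCons_infinitePi {α : Type*} [MeasurableSpace α] (κ : Measure α)
    [IsProbabilityMeasure κ] :
    (κ.prod (Measure.infinitePi fun _ : ℕ => κ)).map (fun p => seqCons p.1 p.2) =
      Measure.infinitePi fun _ : ℕ => κ := by
  classical
  refine Measure.eq_infinitePi _ fun s t ht => ?_
  obtain ⟨N, hN⟩ := s.exists_nat_subset_range
  have hN' : s ⊆ Finset.range (N + 1) := hN.trans (Finset.range_mono (Nat.le_succ N))
  -- Padding by `univ` makes the index set an initial segment, so the cylinder pulls back to a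
  -- rectangle: head times cylinder of the tail.
  set t' : ℕ → Set α := fun i => if i ∈ s then t i else univ with ht'
  have hmt' : ∀ i, MeasurableSet (t' i) := by
    intro i
    simp only [ht']
    split_ifs
    exacts [ht i, .univ]
  have hprod : ∏ i ∈ s, κ (t i) = ∏ i ∈ Finset.range (N + 1), κ (t' i) := by
    rw [← Finset.prod_subset hN' (f := fun i => κ (t' i)) fun i _ hi => by simp [ht', hi]]
    exact Finset.prod_congr rfl fun i hi => by simp [ht', hi]
  have hset : Set.pi (s : Set ℕ) t = Set.pi (Finset.range (N + 1) : Set ℕ) t' := by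
    ext x
    simp only [Set.mem_pi, ht']
    constructor
    · intro h i _
      by_cases hi : i ∈ s
      · simpa [hi] using h i hi
      · simp [hi]
    · intro h i hi
      have hi' : i ∈ s := hi
      simpa [hi'] using h i (hN' hi')
  have hpre : (fun p : α × (ℕ → α) => seqCons p.1 p.2) ⁻¹'
      Set.pi (Finset.range (N + 1) : Set ℕ) t' =
      t' 0 ×ˢ Set.pi (Finset.range N : Set ℕ) fun i => t' (i + 1) := by
    ext p
    simp only [mem_preimage, Set.mem_pi, mem_prod, Finset.coe_range, mem_Iio]
    constructor
    · exact fun h => ⟨h 0 (by omega), fun i hi => h (i + 1) (by omega)⟩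
    · rintro ⟨h0, h1⟩ i hi
      cases i with
      | zero => exact h0
      | succ i => exact h1 i (by omega)
  rw [hset, Measure.map_apply measurable_seqCons
    (.pi (Finset.countable_toSet _) fun i _ => hmt' i), hpre, Measure.prod_prod,
    Measure.infinitePi_pi _ fun i _ => hmt' (i + 1), hprod, Finset.prod_range_succ', mul_comm]

lemma lintegral_infinitePi_eq_prod {α : Type*} [MeasurableSpace α] (κ : Measure α)
    [IsProbabilityMeasure κ] {F : (ℕ → α) → ENNReal} (hF : Measurable F) :
    ∫⁻ ω, F ω ∂(Measure.infinitePi fun _ : ℕ => κ) =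
      ∫⁻ a, ∫⁻ w, F (seqCons a w) ∂(Measure.infinitePi fun _ : ℕ => κ) ∂κ := by
  conv_lhs => rw [← map_seqCons_infinitePi κ]
  rw [lintegral_map hF measurable_seqCons,
    lintegral_prod (fun p : α × (ℕ → α) => F (seqCons p.1 p.2))
      (hF.comp measurable_seqCons).aemeasurable]

lemma lintegral_prod_range_infinitePi {α : Type*} [MeasurableSpace α] (κ : Measure α)
    [IsProbabilityMeasure κ] {f : α → ENNReal} (hf : Measurable f) (k : ℕ) :
    ∫⁻ ω, ∏ j ∈ Finset.range k, f (ω j) ∂(Measure.infinitePi fun _ : ℕ => κ) =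
      (∫⁻ a, f a ∂κ) ^ k := by
  induction k with
  | zero => simp
  | succ k ih =>
    have hm : Measurable fun ω : ℕ → α => ∏ j ∈ Finset.range k, f (ω j) :=
      Finset.measurable_prod _ fun j _ => hf.comp (measurable_pi_apply j)
    rw [lintegral_infinitePi_eq_prod κ (F := fun ω => ∏ j ∈ Finset.range (k + 1), f (ω j))
      (Finset.measurable_prod _ fun j _ => hf.comp (measurable_pi_apply j))]
    simp_rw [Finset.prod_range_succ', seqCons]
    simp_rw [lintegral_mul_const _ hm, ih]
    rw [lintegral_const_mul _ hf, pow_succ]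

/-! ### The stick-breaking mean: finiteness and distributional equation. -/

lemma betaMeasure_ae_mem_Ioo (a b : ℝ) : ∀ᵐ v ∂(betaMeasure a b), v ∈ Ioo (0 : ℝ) 1 := by
  rw [ae_iff, betaMeasure]
  refine (withDensity_apply _ measurableSet_Ioo.compl).trans ?_
  refine setLIntegral_eq_zero measurableSet_Ioo.compl fun x hx => ?_
  by_cases h : 0 < x
  · exact betaPDF_eq_zero_of_one_le (not_lt.1 fun h1 => hx ⟨h, h1⟩)
  · exact betaPDF_eq_zero_of_nonpos (not_lt.1 h)

/-- The mean of the nonnegative part of the random measure `randomAtoms ω`, with values in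
`[0, ∞]`. -/
noncomputable def extMean (ω : ℕ → ℝ × ℝ) : ENNReal :=
  ∑' k, ENNReal.ofReal (stickWeight (fun j => (ω j).1) k) * ENNReal.ofReal (ω k).2

lemma measurable_stickWeight (k : ℕ) :
    Measurable fun ω : ℕ → ℝ × ℝ => stickWeight (fun j => (ω j).1) k := by
  unfold stickWeight
  fun_prop

lemma measurable_extMean : Measurable extMean := by
  unfold extMean
  refine Measurable.tsum fun k => ?_
  exact (measurable_stickWeight k).ennreal_ofReal.mul (by fun_prop)

lemma lintegral_randomAtoms (ω : ℕ → ℝ × ℝ) :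
    ∫⁻ x, ENNReal.ofReal x ∂(randomAtoms ω) = extMean ω := by
  simp [randomAtoms, extMean, lintegral_sum_measure, lintegral_smul_measure]

lemma randomAtoms_ae_nonneg {ω : ℕ → ℝ × ℝ} (h : ∀ k, 0 ≤ (ω k).2) :
    ∀ᵐ x ∂(randomAtoms ω), 0 ≤ x := by
  rw [ae_iff, randomAtoms]
  have hset : {x : ℝ | ¬0 ≤ x} = Iio 0 := by ext; simp
  rw [hset, Measure.sum_apply _ measurableSet_Iio]
  simp [h]

lemma integral_randomAtoms {ω : ℕ → ℝ × ℝ} (h : ∀ k, 0 ≤ (ω k).2) :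
    ∫ x, x ∂(randomAtoms ω) = (extMean ω).toReal := by
  rw [integral_eq_lintegral_of_nonneg_ae (randomAtoms_ae_nonneg h) (by fun_prop),
    lintegral_randomAtoms]

lemma integrable_randomAtoms {ω : ℕ → ℝ × ℝ} (h : ∀ k, 0 ≤ (ω k).2) (hfin : extMean ω < ⊤) :
    Integrable (fun x => x) (randomAtoms ω) := by
  refine ⟨by fun_prop, ?_⟩
  rw [hasFiniteIntegral_iff_ofReal (randomAtoms_ae_nonneg h), lintegral_randomAtoms]
  exact hfin

/-- Self-similarity of stick-breaking: after the first break, the tail of the sequence breaks the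
remaining length 1 - p.1 just as a whole stick. -/
lemma extMean_seqCons {p : ℝ × ℝ} (hp : p.1 ≤ 1) (w : ℕ → ℝ × ℝ) :
    extMean (seqCons p w) =
      ENNReal.ofReal p.1 * ENNReal.ofReal p.2 + ENNReal.ofReal (1 - p.1) * extMean w := by
  unfold extMean
  rw [tsum_eq_zero_add' ENNReal.summable, ← ENNReal.tsum_mul_left]
  congr 1
  · simp [stickWeight, seqCons]
  · refine tsum_congr fun k => ?_
    rw [← mul_assoc, ← ENNReal.ofReal_mul (sub_nonneg.2 hp)]
    simp only [stickWeight, Finset.prod_range_succ', seqCons]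
    congr 2
    ring

lemma prod_ae_stick_nonneg {θ : ℝ} {H : Measure ℝ} (hθ : 0 < θ) (hH : ∀ᵐ x ∂H, 0 ≤ x) :
    ∀ᵐ p ∂((betaMeasure 1 θ).prod H), p.1 ∈ Ioo (0 : ℝ) 1 ∧ 0 ≤ p.2 := by
  have := isProbabilityMeasureBeta one_pos hθ
  filter_upwards [Measure.quasiMeasurePreserving_fst.ae (betaMeasure_ae_mem_Ioo 1 θ),
    Measure.quasiMeasurePreserving_snd.ae hH] with p h1 h2 using ⟨h1, h2⟩

section Base

variable {θ : ℝ} {H : Measure ℝ} [IsProbabilityMeasure H]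

lemma isProbabilityMeasure_dirichletBase (hθ : 0 < θ) :
    IsProbabilityMeasure (dirichletBase θ H) := by
  have := isProbabilityMeasureBeta one_pos hθ
  unfold dirichletBase; infer_instance

lemma dirichletBase_ae_forall (hθ : 0 < θ) {p : ℝ × ℝ → Prop}
    (hp : ∀ᵐ x ∂((betaMeasure 1 θ).prod H), p x) :
    ∀ᵐ ω ∂(dirichletBase θ H), ∀ k, p (ω k) := by
  have := isProbabilityMeasureBeta one_pos hθ
  rw [ae_all_iff]
  intro k
  exact (measurePreserving_eval_infinitePi (fun _ : ℕ => (betaMeasure 1 θ).prod H)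
    k).quasiMeasurePreserving.ae hp

lemma sum_stickWeight (v : ℕ → ℝ) (n : ℕ) :
    ∑ k ∈ Finset.range n, stickWeight v k = 1 - ∏ j ∈ Finset.range n, (1 - v j) := by
  induction n with
  | zero => simp
  | succ n ih => rw [Finset.sum_range_succ, ih, Finset.prod_range_succ, stickWeight]; ring

lemma stickWeight_nonneg {v : ℕ → ℝ} (hv : ∀ k, v k ∈ Ioo (0 : ℝ) 1) (k : ℕ) :
    0 ≤ stickWeight v k :=
  mul_nonneg (hv k).1.le (Finset.prod_nonneg fun j _ => sub_nonneg.2 (hv j).2.le)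

lemma extMean_le_one {ω : ℕ → ℝ × ℝ} (hv : ∀ k, (ω k).1 ∈ Ioo (0 : ℝ) 1)
    (hz : ∀ k, (ω k).2 ≤ 1) : extMean ω ≤ 1 := by
  refine ENNReal.tsum_le_of_sum_range_le fun n => ?_
  calc ∑ k ∈ Finset.range n, ENNReal.ofReal (stickWeight (fun j => (ω j).1) k) *
        ENNReal.ofReal (ω k).2
      ≤ ∑ k ∈ Finset.range n, ENNReal.ofReal (stickWeight (fun j => (ω j).1) k) := by
        refine Finset.sum_le_sum fun k _ => mul_le_of_le_one_right' ?_
        simpa using hz k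
    _ = ENNReal.ofReal (1 - ∏ j ∈ Finset.range n, (1 - (ω j).1)) := by
        rw [← sum_stickWeight, ENNReal.ofReal_sum_of_nonneg fun k _ => stickWeight_nonneg hv k]
    _ ≤ 1 := by
        rw [ENNReal.ofReal_le_one]
        have := Finset.prod_nonneg fun j (_ : j ∈ Finset.range n) => sub_nonneg.2 (hv j).2.le
        linarith

/-- The condition r^k < x forces k < log(1+x)/log r, so the sum is dominated by a tail sum of an
integrable variable. This feeds Borel-Cantelli. -/
lemma tsum_measure_gt_pow_lt_top {r : ℝ} (hr : 1 < r)
    (hlog : Integrable (fun x => Real.log (1 + x)) H) :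
    ∑' k : ℕ, H {x | r ^ k < x} < ⊤ := by
  have hlr : 0 < Real.log r := Real.log_pos hr
  have := @tsum_prob_mem_Ioi_lt_top ℝ ⟨H⟩ ‹_› (fun x => |Real.log (1 + x)| / Real.log r)
    (hlog.abs.div_const _) (fun x => by positivity)
  refine lt_of_le_of_lt (ENNReal.tsum_le_tsum fun k => measure_mono fun x hx => ?_) this
  have hk : 0 < r ^ k := by positivity
  have hx' : r ^ k < x := hx
  change (k : ℝ) < |Real.log (1 + x)| / Real.log r
  rw [lt_div_iff₀ hlr, ← Real.log_pow]
  exact (Real.log_lt_log hk (by linarith)).trans_le (le_abs_self _)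

/-- The Dirichlet mean is almost surely finite. -/
lemma extMean_lt_top (hθ : 0 < θ)
    (hlog : Integrable (fun x => Real.log (1 + x)) H) :
    ∀ᵐ ω ∂(dirichletBase θ H), extMean ω < ⊤ := by
  have := isProbabilityMeasureBeta one_pos hθ
  have := isProbabilityMeasure_dirichletBase (H := H) hθ
  set κ := (betaMeasure 1 θ).prod H with hκ
  have hmq : Measurable fun p : ℝ × ℝ => ENNReal.ofReal (1 - p.1) := by fun_prop
  set q := ∫⁻ p, ENNReal.ofReal (1 - p.1) ∂κ with hq
  have hq1 : q < 1 := by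
    have h1 : ∫⁻ _ : ℝ × ℝ, (1 : ENNReal) ∂κ = 1 := by simp
    have hlt : ∀ᵐ p ∂κ, ENNReal.ofReal (1 - p.1) < 1 := by
      filter_upwards [Measure.quasiMeasurePreserving_fst.ae (betaMeasure_ae_mem_Ioo 1 θ)]
        with p hp
      rw [ENNReal.ofReal_lt_one]
      linarith [hp.1]
    rw [← h1]
    refine lintegral_strict_mono (IsProbabilityMeasure.ne_zero κ) (by fun_prop) ?_ hlt
    refine (lt_of_le_of_lt (lintegral_mono_ae (hlt.mono fun p hp => hp.le)) ?_).ne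
    simp
  set q' := q.toReal
  have hq'0 : 0 ≤ q' := ENNReal.toReal_nonneg
  have hq'1 : q' < 1 := by
    simpa using (ENNReal.toReal_lt_toReal hq1.ne_top ENNReal.one_ne_top).2 hq1
  have hqq : q = ENNReal.ofReal q' := (ENNReal.ofReal_toReal hq1.ne_top).symm
  -- Any r with 1 < r and rq < 1 serves: atoms may then grow like r^k while the unbroken stick
  -- shrinks on average like q^k.
  set r : ℝ := 2 / (1 + q') with hr
  have hr1 : 1 < r := by rw [hr, lt_div_iff₀ (by linarith)]; linarith
  have hrq : ENNReal.ofReal r * q < 1 := by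
    rw [hqq, ← ENNReal.ofReal_mul (by linarith), ENNReal.ofReal_lt_one, hr, div_mul_eq_mul_div,
      div_lt_one (by linarith)]
    linarith
  have hmprod : ∀ k, Measurable fun ω : ℕ → ℝ × ℝ =>
      ∏ j ∈ Finset.range k, ENNReal.ofReal (1 - (ω j).1) := fun k =>
    Finset.measurable_prod _ fun j _ => hmq.comp (measurable_pi_apply j)
  -- By independence the expectation of this series is the geometric series of (rq)^k.
  have hsum : ∀ᵐ ω ∂(dirichletBase θ H), ∑' k : ℕ, ENNReal.ofReal r ^ k *
      ∏ j ∈ Finset.range k, ENNReal.ofReal (1 - (ω j).1) < ⊤ := by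
    refine ae_lt_top (Measurable.tsum fun k => (hmprod k).const_mul _) ?_
    rw [lintegral_tsum fun k => ((hmprod k).const_mul _).aemeasurable]
    have hterm : ∀ k : ℕ, ∫⁻ ω, ENNReal.ofReal r ^ k *
        ∏ j ∈ Finset.range k, ENNReal.ofReal (1 - (ω j).1) ∂(dirichletBase θ H) =
        (ENNReal.ofReal r * q) ^ k := by
      intro k
      rw [lintegral_const_mul _ (hmprod k), mul_pow]
      congr 1
      exact lintegral_prod_range_infinitePi κ hmq k
    simp_rw [hterm]
    rw [ENNReal.tsum_geometric]
    simpa [tsub_eq_zero_iff_le] using hrq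
  -- Borel-Cantelli, from the logarithmic moment of H.
  have hev : ∀ᵐ ω ∂(dirichletBase θ H), ∀ᶠ k : ℕ in Filter.atTop, (ω k).2 ≤ r ^ k := by
    have hb : ∑' k : ℕ, dirichletBase θ H {ω | r ^ k < (ω k).2} ≠ ⊤ := by
      have h2 : ∀ k : ℕ, dirichletBase θ H {ω | r ^ k < (ω k).2} = H {x | r ^ k < x} := by
        intro k
        have hmp : MeasurePreserving (fun ω : ℕ → ℝ × ℝ => (ω k).2) (dirichletBase θ H) H :=
          measurePreserving_snd.comp (measurePreserving_eval_infinitePi (fun _ : ℕ => κ) k)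
        exact hmp.measure_preimage measurableSet_Ioi.nullMeasurableSet
      simp_rw [h2]
      exact (tsum_measure_gt_pow_lt_top hr1 hlog).ne
    filter_upwards [ae_eventually_notMem hb] with ω hω
    filter_upwards [hω] with k hk
    simpa using hk
  have hv := dirichletBase_ae_forall (H := H) hθ
    (Measure.quasiMeasurePreserving_fst.ae (betaMeasure_ae_mem_Ioo 1 θ))
  filter_upwards [hsum, hev, hv] with ω h1 h2 h3
  obtain ⟨N, hN⟩ := Filter.eventually_atTop.1 h2
  -- The sum absorbs the finitely many atoms before N; the 1 serves those after.
  set C : ENNReal := 1 + ∑ j ∈ Finset.range N, ENNReal.ofReal (ω j).2 with hC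
  have hCtop : C ≠ ⊤ := by
    simp [hC, ENNReal.sum_eq_top]
  have hr1' : (1 : ENNReal) ≤ ENNReal.ofReal r := by simpa using hr1.le
  have hz : ∀ k, ENNReal.ofReal (ω k).2 ≤ C * ENNReal.ofReal r ^ k := by
    intro k
    by_cases hk : k < N
    · calc ENNReal.ofReal (ω k).2 ≤ ∑ j ∈ Finset.range N, ENNReal.ofReal (ω j).2 :=
            Finset.single_le_sum (f := fun j => ENNReal.ofReal (ω j).2) (fun _ _ => zero_le)
              (Finset.mem_range.2 hk)
        _ ≤ C := le_add_self
        _ ≤ C * ENNReal.ofReal r ^ k := le_mul_of_one_le_right' (one_le_pow₀ hr1')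
    · calc ENNReal.ofReal (ω k).2 ≤ ENNReal.ofReal (r ^ k) :=
            ENNReal.ofReal_le_ofReal (hN k (not_lt.1 hk))
        _ = ENNReal.ofReal r ^ k := ENNReal.ofReal_pow (by linarith) k
        _ ≤ C * ENNReal.ofReal r ^ k := le_mul_of_one_le_left' le_self_add
  have hw : ∀ k, ENNReal.ofReal (stickWeight (fun j => (ω j).1) k) ≤
      ∏ j ∈ Finset.range k, ENNReal.ofReal (1 - (ω j).1) := by
    intro k
    rw [← ENNReal.ofReal_prod_of_nonneg fun j _ => sub_nonneg.2 (h3 j).2.le]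
    exact ENNReal.ofReal_le_ofReal (mul_le_of_le_one_left
      (Finset.prod_nonneg fun j _ => sub_nonneg.2 (h3 j).2.le) (h3 k).2.le)
  calc extMean ω ≤ ∑' k : ℕ, C * (ENNReal.ofReal r ^ k *
        ∏ j ∈ Finset.range k, ENNReal.ofReal (1 - (ω j).1)) := by
        refine ENNReal.tsum_le_tsum fun k => (mul_le_mul' (hw k) (hz k)).trans (le_of_eq ?_)
        ring
    _ < ⊤ := by
        rw [ENNReal.tsum_mul_left]
        exact ENNReal.mul_lt_top hCtop.lt_top h1

lemma dirichletMeanLaw_eq_map (hθ : 0 < θ) (hH : ∀ᵐ x ∂H, 0 ≤ x) :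
    dirichletMeanLaw θ H = (dirichletBase θ H).map fun ω => (extMean ω).toReal := by
  refine Measure.map_congr ?_
  filter_upwards [dirichletBase_ae_forall hθ (prod_ae_stick_nonneg hθ hH)] with ω hω
  exact integral_randomAtoms fun k => (hω k).2

lemma isProbabilityMeasure_dirichletMeanLaw (hθ : 0 < θ) (hH : ∀ᵐ x ∂H, 0 ≤ x) :
    IsProbabilityMeasure (dirichletMeanLaw θ H) := by
  have := isProbabilityMeasure_dirichletBase (H := H) hθ
  rw [dirichletMeanLaw_eq_map hθ hH]
  exact Measure.isProbabilityMeasure_map measurable_extMean.ennreal_toReal.aemeasurable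

lemma dirichletMeanLaw_ae_nonneg (hθ : 0 < θ) (hH : ∀ᵐ x ∂H, 0 ≤ x) :
    ∀ᵐ m ∂(dirichletMeanLaw θ H), 0 ≤ m := by
  rw [dirichletMeanLaw_eq_map hθ hH]
  exact (ae_map_iff measurable_extMean.ennreal_toReal.aemeasurable measurableSet_Ici).2
    (ae_of_all _ fun ω => ENNReal.toReal_nonneg)

lemma dirichletMeanLaw_ae_le_one (hθ : 0 < θ) (hH : ∀ᵐ x ∂H, x ∈ Icc (0 : ℝ) 1) :
    ∀ᵐ m ∂(dirichletMeanLaw θ H), m ∈ Icc (0 : ℝ) 1 := by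
  have := isProbabilityMeasureBeta one_pos hθ
  rw [dirichletMeanLaw_eq_map hθ (hH.mono fun x hx => hx.1)]
  refine (ae_map_iff measurable_extMean.ennreal_toReal.aemeasurable measurableSet_Icc).2 ?_
  filter_upwards [dirichletBase_ae_forall (H := H) hθ
    (Measure.quasiMeasurePreserving_fst.ae (betaMeasure_ae_mem_Ioo 1 θ)),
    dirichletBase_ae_forall (H := H) hθ (Measure.quasiMeasurePreserving_snd.ae hH)] with ω h1 h2
  exact ⟨ENNReal.toReal_nonneg, ENNReal.toReal_le_of_le_ofReal zero_le_one
    (by simpa using extMean_le_one h1 fun k => (h2 k).2)⟩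

lemma ae_integrable_randomAtoms (hθ : 0 < θ) (hH : ∀ᵐ x ∂H, 0 ≤ x)
    (hlog : Integrable (fun x => Real.log (1 + x)) H) :
    ∀ᵐ ω ∂(dirichletBase θ H), Integrable (fun x => x) (randomAtoms ω) := by
  filter_upwards [dirichletBase_ae_forall hθ (prod_ae_stick_nonneg hθ hH), extMean_lt_top hθ hlog]
    with ω h1 h2
  exact integrable_randomAtoms (fun k => (h1 k).2) h2

/-- The distributional equation `M = V Z + (1 - V) M'` of the Dirichlet mean. -/
lemma lintegral_dirichletMeanLaw (hθ : 0 < θ) (hH : ∀ᵐ x ∂H, 0 ≤ x)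
    (hlog : Integrable (fun x => Real.log (1 + x)) H) {F : ℝ → ENNReal} (hF : Measurable F) :
    ∫⁻ m, F m ∂(dirichletMeanLaw θ H) =
      ∫⁻ p, ∫⁻ m, F (p.1 * p.2 + (1 - p.1) * m) ∂(dirichletMeanLaw θ H)
        ∂((betaMeasure 1 θ).prod H) := by
  have := isProbabilityMeasureBeta one_pos hθ
  have hm := measurable_extMean.ennreal_toReal
  rw [dirichletMeanLaw_eq_map hθ hH, lintegral_map hF hm]
  conv_lhs => unfold dirichletBase
  rw [lintegral_infinitePi_eq_prod _ (F := fun ω => F (extMean ω).toReal) (hF.comp hm)]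
  refine lintegral_congr_ae ?_
  filter_upwards [prod_ae_stick_nonneg hθ hH] with p hp
  rw [lintegral_map (by fun_prop) hm]
  refine lintegral_congr_ae ?_
  -- `toReal` sends ⊤ to 0 and is additive only on finite values, so almost sure finiteness is
  -- needed to pass from [0, ∞] to ℝ.
  filter_upwards [extMean_lt_top hθ hlog] with w hw
  rw [extMean_seqCons hp.1.2.le, ENNReal.toReal_add
    (ENNReal.mul_ne_top ENNReal.ofReal_ne_top ENNReal.ofReal_ne_top)
    (ENNReal.mul_ne_top ENNReal.ofReal_ne_top hw.ne), ENNReal.toReal_mul, ENNReal.toReal_mul,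
    ENNReal.toReal_ofReal hp.1.1.le, ENNReal.toReal_ofReal hp.2,
    ENNReal.toReal_ofReal (sub_nonneg.2 hp.1.2.le)]

end Base

/-! ### Feynman's formula for Beta(1, θ). -/

lemma one_div_beta_one {θ : ℝ} (hθ : 0 < θ) : 1 / beta 1 θ = θ := by
  have h := (Real.Gamma_pos_of_pos hθ).ne'
  rw [beta, Real.Gamma_one, one_mul, add_comm, Real.Gamma_add_one hθ.ne']
  field_simp

/-- The Feynman parametrization of `a⁻¹ b ^ (-θ)`. -/
lemma lintegral_betaMeasure_one {θ : ℝ} (hθ : 0 < θ) {a b : ℝ} (ha : 0 < a) (hb : 0 < b) :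
    ∫⁻ v, ENNReal.ofReal ((v * a + (1 - v) * b) ^ (-(θ + 1))) ∂(betaMeasure 1 θ) =
      ENNReal.ofReal (a⁻¹ * b ^ (-θ)) := by
  set D : ℝ → ℝ := fun v => v * a + (1 - v) * b with hD
  have hDpos : ∀ v ∈ Icc (0 : ℝ) 1, 0 < D v := by
    intro v hv
    simp only [hD]
    rcases eq_or_lt_of_le hv.1 with h | h
    · simpa [← h] using hb
    · nlinarith [mul_pos h ha, mul_nonneg (sub_nonneg.2 hv.2) hb.le]
  -- Since ((1-v)/D)' = -a/D², this is an antiderivative of the beta density times D^(-(θ+1)); it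
  -- vanishes at 1 and equals -a⁻¹ b^(-θ) at 0.
  set G : ℝ → ℝ := fun v => -(a⁻¹ * ((1 - v) / D v) ^ θ) with hG
  have hcont : ContinuousOn G (Icc 0 1) := by
    refine (continuousOn_const.mul (ContinuousOn.rpow_const ?_ fun v _ => Or.inr hθ.le)).neg
    exact (by fun_prop : ContinuousOn (fun v : ℝ => 1 - v) _).div (by fun_prop)
      fun v hv => (hDpos v hv).ne'
  have hderiv : ∀ v ∈ Ioo (0 : ℝ) 1,
      HasDerivAt G (θ * (1 - v) ^ (θ - 1) * D v ^ (-(θ + 1))) v := by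
    intro v hv
    have hv1 : 0 < 1 - v := sub_pos.2 hv.2
    have hDv := hDpos v (Ioo_subset_Icc_self hv)
    have h1 : HasDerivAt (fun v : ℝ => 1 - v) (-1) v := by
      simpa using (hasDerivAt_id v).const_sub 1
    have h2 : HasDerivAt D (a - b) v := by
      exact (((hasDerivAt_id v).mul_const a).add (h1.mul_const b)).congr_deriv (by ring)
    have h3 := (((h1.div h2 hDv.ne').rpow_const (p := θ)
      (Or.inl (div_pos hv1 hDv).ne')).const_mul a⁻¹).neg
    refine h3.congr_deriv ?_
    simp only [Pi.div_apply]
    rw [Real.div_rpow hv1.le hDv.le, show -(θ + 1) = -(θ - 1) - (2 : ℕ) by push_cast; ring,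
      Real.rpow_sub_natCast hDv.ne', Real.rpow_neg hDv.le]
    have h4 : D v ^ (θ - 1) ≠ 0 := (Real.rpow_pos_of_pos hDv _).ne'
    have h5 : -1 * D v - (1 - v) * (a - b) = -a := by simp only [hD]; ring
    rw [h5]
    field_simp
  have hpos : ∀ v ∈ Ioo (0 : ℝ) 1, 0 ≤ θ * (1 - v) ^ (θ - 1) * D v ^ (-(θ + 1)) := by
    intro v hv
    have := Real.rpow_nonneg (sub_pos.2 hv.2).le (θ - 1)
    have := Real.rpow_nonneg (hDpos v (Ioo_subset_Icc_self hv)).le (-(θ + 1))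
    positivity
  -- For θ < 1 the integrand is singular at 1; integrability comes from its sign and the continuity
  -- of its antiderivative up to the endpoint.
  have hint : IntegrableOn (fun v => θ * (1 - v) ^ (θ - 1) * D v ^ (-(θ + 1))) (Ioc 0 1) :=
    intervalIntegral.integrableOn_deriv_of_nonneg hcont hderiv hpos
  have hval : ∫ v in Ioc (0 : ℝ) 1, θ * (1 - v) ^ (θ - 1) * D v ^ (-(θ + 1)) = a⁻¹ * b ^ (-θ) := by
    rw [← intervalIntegral.integral_of_le zero_le_one,
      intervalIntegral.integral_eq_sub_of_hasDerivAt_of_le zero_le_one hcont hderiv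
        ((intervalIntegrable_iff_integrableOn_Ioc_of_le zero_le_one).2 hint)]
    simp [hG, hD, Real.zero_rpow hθ.ne', Real.inv_rpow hb.le, Real.rpow_neg hb.le]
  have hDm : Measurable fun v => ENNReal.ofReal (D v ^ (-(θ + 1))) := by
    simp only [hD]; fun_prop
  have hpdf : Measurable (betaPDF 1 θ) := (measurable_betaPDFReal 1 θ).ennreal_ofReal
  rw [← hval, ofReal_integral_eq_lintegral_ofReal hint, betaMeasure,
    lintegral_withDensity_eq_lintegral_mul _ hpdf hDm, ← restrict_Ioo_eq_restrict_Ioc,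
    ← lintegral_indicator measurableSet_Ioo]
  · refine lintegral_congr fun v => ?_
    rw [Pi.mul_apply]
    by_cases hv : v ∈ Ioo (0 : ℝ) 1
    · rw [indicator_of_mem hv, betaPDF_of_pos_lt_one hv.1 hv.2, one_div_beta_one hθ,
        ← ENNReal.ofReal_mul]
      · simp
      · have := Real.rpow_nonneg (sub_pos.2 hv.2).le (θ - 1)
        have := Real.rpow_nonneg hv.1.le ((1 : ℝ) - 1)
        positivity
    · rw [indicator_of_notMem hv]
      have : betaPDF 1 θ v = 0 := by
        by_cases h : 0 < v
        · exact betaPDF_eq_zero_of_one_le (not_lt.1 fun h1 => hv ⟨h, h1⟩)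
        · exact betaPDF_eq_zero_of_nonpos (not_lt.1 h)
      rw [this, zero_mul]
  · rw [← restrict_Ioo_eq_restrict_Ioc]
    exact ae_restrict_of_forall_mem measurableSet_Ioo hpos

/-! ### Derivatives of the transforms and their limits at 0+. -/

section Stieltjes

variable {ρ : Measure ℝ} [IsProbabilityMeasure ρ]

lemma one_add_mul_rpow_neg_le_one {z m p : ℝ} (hz : 0 ≤ z) (hm : 0 ≤ m) (hp : 0 ≤ p) :
    (1 + z * m) ^ (-p) ≤ 1 :=
  Real.rpow_le_one_of_one_le_of_nonpos (by nlinarith [mul_nonneg hz hm]) (by linarith)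

lemma integrable_one_add_mul_rpow_neg (hρ : ∀ᵐ m ∂ρ, 0 ≤ m) {z p : ℝ} (hz : 0 ≤ z) (hp : 0 ≤ p) :
    Integrable (fun m => (1 + z * m) ^ (-p)) ρ := by
  refine Integrable.of_bound (Measurable.aestronglyMeasurable (by fun_prop)) 1 ?_
  filter_upwards [hρ] with m hm
  rw [Real.norm_eq_abs, abs_of_nonneg (Real.rpow_nonneg (by nlinarith [mul_nonneg hz hm]) _)]
  exact one_add_mul_rpow_neg_le_one hz hm hp

/-- A bound uniform in m, which allows differentiation under the integral without a first moment. -/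
lemma div_one_add_mul_le {z m : ℝ} (hz : 0 < z) (hm : 0 ≤ m) : m / (1 + z * m) ≤ 1 / z := by
  rw [div_le_div_iff₀ (by positivity) hz]
  linarith

/-- Writing zm = (1+zm) - 1 expresses the derivative through the transforms of exponents p and p+1,
the two that the distributional equation relates for p = θ. -/
lemma hasDerivAt_stieltjes (hρ : ∀ᵐ m ∂ρ, 0 ≤ m) {z p : ℝ} (hz : 0 < z) (hp : 0 < p) :
    HasDerivAt (fun z => ∫ m, (1 + z * m) ^ (-p) ∂ρ)
      (-p / z * (∫ m, (1 + z * m) ^ (-p) ∂ρ - ∫ m, (1 + z * m) ^ (-(p + 1)) ∂ρ)) z := by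
  have key := hasDerivAt_integral_of_dominated_loc_of_deriv_le (μ := ρ)
    (F := fun z m => (1 + z * m) ^ (-p)) (F' := fun z m => m * -p * (1 + z * m) ^ (-p - 1))
    (bound := fun _ => p * (2 / z)) (x₀ := z) (s := Ioi (z / 2)) (Ioi_mem_nhds (by linarith))
    (Filter.Eventually.of_forall fun z => Measurable.aestronglyMeasurable (by fun_prop))
    (integrable_one_add_mul_rpow_neg hρ hz.le hp.le)
    (Measurable.aestronglyMeasurable (by fun_prop)) ?_ (integrable_const _) ?_
  · refine key.2.congr_deriv ?_
    rw [← integral_sub (integrable_one_add_mul_rpow_neg hρ hz.le hp.le)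
      (integrable_one_add_mul_rpow_neg hρ hz.le (by linarith)), ← integral_const_mul]
    refine integral_congr_ae ?_
    filter_upwards [hρ] with m hm
    have h1 : 0 < 1 + z * m := by positivity
    rw [show -(p + 1) = -p - 1 by ring]
    have : (1 + z * m) ^ (-p) = (1 + z * m) ^ (-p - 1) * (1 + z * m) := by
      rw [Real.rpow_sub_one h1.ne']; field_simp
    rw [this]
    field_simp
    ring
  · filter_upwards [hρ] with m hm w hw
    have hw0 : 0 < w := lt_trans (by linarith) hw
    have h1 : 1 ≤ 1 + w * m := by nlinarith [mul_nonneg hw0.le hm]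
    have h2 : (1 + w * m) ^ (-p - 1) ≤ (1 + w * m)⁻¹ := by
      rw [← Real.rpow_neg_one]
      exact Real.rpow_le_rpow_of_exponent_le h1 (by linarith)
    have h3 : 0 ≤ (1 + w * m) ^ (-p - 1) := Real.rpow_nonneg (by linarith) _
    rw [Real.norm_eq_abs, abs_mul, abs_mul, abs_neg, abs_of_nonneg hm, abs_of_pos hp,
      abs_of_nonneg h3]
    calc m * p * (1 + w * m) ^ (-p - 1) ≤ m * p * (1 + w * m)⁻¹ := by gcongr
      _ = p * (m / (1 + w * m)) := by ring
      _ ≤ p * (1 / w) := mul_le_mul_of_nonneg_left (div_one_add_mul_le hw0 hm) hp.le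
      _ ≤ p * (2 / z) := by
        gcongr p * ?_
        rw [div_le_div_iff₀ hw0 hz]
        have : z / 2 < w := hw
        linarith
  · filter_upwards [hρ] with m hm w hw
    have hw0 : 0 < w := lt_trans (by linarith) hw
    have h1 : 0 < 1 + w * m := by positivity
    have h2 : HasDerivAt (fun w : ℝ => 1 + w * m) m w := by
      simpa using ((hasDerivAt_id w).mul_const m).const_add 1
    exact h2.rpow_const (Or.inl h1.ne')

/-- Because 1 + zx ≤ (1+z)(1+x). -/
lemma integrable_log_one_add_mul (hρ : ∀ᵐ m ∂ρ, 0 ≤ m)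
    (hlog : Integrable (fun x => Real.log (1 + x)) ρ) {z : ℝ} (hz : 0 ≤ z) :
    Integrable (fun x => Real.log (1 + z * x)) ρ := by
  refine Integrable.mono' (hlog.add (integrable_const (Real.log (1 + z))))
    (Measurable.aestronglyMeasurable (by fun_prop)) ?_
  filter_upwards [hρ] with x hx
  have := mul_nonneg hz hx
  rw [Real.norm_eq_abs, abs_of_nonneg (Real.log_nonneg (by linarith)), Pi.add_apply,
    ← Real.log_mul (by positivity) (by positivity)]
  exact Real.log_le_log (by positivity) (by nlinarith)

lemma hasDerivAt_integral_log (hρ : ∀ᵐ m ∂ρ, 0 ≤ m)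
    (hlog : Integrable (fun x => Real.log (1 + x)) ρ) {z : ℝ} (hz : 0 < z) :
    HasDerivAt (fun z => ∫ x, Real.log (1 + z * x) ∂ρ)
      (1 / z * (1 - ∫ x, (1 + z * x)⁻¹ ∂ρ)) z := by
  have key := hasDerivAt_integral_of_dominated_loc_of_deriv_le (μ := ρ)
    (F := fun z x => Real.log (1 + z * x)) (F' := fun z x => x / (1 + z * x))
    (bound := fun _ => 2 / z) (x₀ := z) (s := Ioi (z / 2)) (Ioi_mem_nhds (by linarith))
    (Filter.Eventually.of_forall fun z => Measurable.aestronglyMeasurable (by fun_prop))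
    (integrable_log_one_add_mul hρ hlog hz.le)
    (Measurable.aestronglyMeasurable (by fun_prop)) ?_ (integrable_const _) ?_
  · refine key.2.congr_deriv ?_
    have hi : Integrable (fun x => (1 + z * x)⁻¹) ρ := by
      simpa [Real.rpow_neg_one] using integrable_one_add_mul_rpow_neg hρ hz.le zero_le_one
    have h1 : (1 : ℝ) = ∫ _, (1 : ℝ) ∂ρ := by simp
    conv_rhs => enter [2, 1]; rw [h1]
    rw [← integral_sub (integrable_const _) hi, ← integral_const_mul]
    refine integral_congr_ae ?_
    filter_upwards [hρ] with m hm
    have h1 : 0 < 1 + z * m := by positivity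
    field_simp
    ring
  · filter_upwards [hρ] with m hm w hw
    have hw0 : 0 < w := lt_trans (by linarith) hw
    rw [Real.norm_eq_abs, abs_of_nonneg (by positivity)]
    refine (div_one_add_mul_le hw0 hm).trans ?_
    rw [div_le_div_iff₀ hw0 hz]
    have : z / 2 < w := hw
    linarith
  · filter_upwards [hρ] with m hm w hw
    have hw0 : 0 < w := lt_trans (by linarith) hw
    have h1 : 0 < 1 + w * m := by positivity
    have h2 : HasDerivAt (fun w : ℝ => 1 + w * m) m w := by
      simpa using ((hasDerivAt_id w).mul_const m).const_add 1
    exact h2.log h1.ne'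

lemma tendsto_stieltjes_zero (hρ : ∀ᵐ m ∂ρ, 0 ≤ m) {p : ℝ} (hp : 0 < p) :
    Filter.Tendsto (fun z => ∫ m, (1 + z * m) ^ (-p) ∂ρ) (nhdsWithin 0 (Ioi 0)) (nhds 1) := by
  have h1 : (1 : ℝ) = ∫ _, (1 : ℝ) ∂ρ := by simp
  nth_rewrite 2 [h1]
  refine tendsto_integral_filter_of_dominated_convergence (fun _ => 1)
    (Filter.Eventually.of_forall fun z => Measurable.aestronglyMeasurable (by fun_prop)) ?_ (integrable_const _) ?_
  · filter_upwards [self_mem_nhdsWithin] with z hz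
    filter_upwards [hρ] with m hm
    have := mul_nonneg (le_of_lt (mem_Ioi.1 hz)) hm
    rw [Real.norm_eq_abs, abs_of_nonneg (Real.rpow_nonneg (by linarith) _)]
    exact one_add_mul_rpow_neg_le_one (le_of_lt hz) hm hp.le
  · filter_upwards with m
    refine tendsto_nhdsWithin_of_tendsto_nhds ?_
    have : ContinuousAt (fun z : ℝ => (1 + z * m) ^ (-p)) 0 :=
      (by fun_prop : ContinuousAt (fun z : ℝ => 1 + z * m) 0).rpow_const (Or.inl (by simp))
    simpa [ContinuousAt] using this

lemma tendsto_integral_log_zero {μ : Measure ℝ} (hμ : ∀ᵐ m ∂μ, 0 ≤ m)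
    (hlog : Integrable (fun x => Real.log (1 + x)) μ) :
    Filter.Tendsto (fun z => ∫ x, Real.log (1 + z * x) ∂μ) (nhdsWithin 0 (Ioi 0)) (nhds 0) := by
  have h1 : (0 : ℝ) = ∫ _, (0 : ℝ) ∂μ := by simp
  nth_rewrite 3 [h1]
  refine tendsto_integral_filter_of_dominated_convergence (fun x => Real.log (1 + x))
    (Filter.Eventually.of_forall fun z => Measurable.aestronglyMeasurable (by fun_prop)) ?_ hlog ?_
  · filter_upwards [self_mem_nhdsWithin, nhdsWithin_le_nhds (Iio_mem_nhds one_pos)] with z hz hz1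
    filter_upwards [hμ] with m hm
    have := mul_nonneg (le_of_lt (mem_Ioi.1 hz)) hm
    rw [Real.norm_eq_abs, abs_of_nonneg (Real.log_nonneg (by linarith))]
    exact Real.log_le_log (by positivity) (by nlinarith [mem_Iio.1 hz1])
  · filter_upwards with m
    refine tendsto_nhdsWithin_of_tendsto_nhds ?_
    have : ContinuousAt (fun z : ℝ => Real.log (1 + z * m)) 0 :=
      (by fun_prop : ContinuousAt (fun z : ℝ => 1 + z * m) 0).log (by simp)
    simpa [ContinuousAt] using this

end Stieltjes

/-! ### The Markov-Krein identity. -/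

section MarkovKrein

variable {θ : ℝ} {H : Measure ℝ} [IsProbabilityMeasure H]

/-- From M = VZ + (1-V)M', the base 1 + zM becomes V(1+zZ) + (1-V)(1+zM'). The exponent θ+1 is the
one for which averaging over V separates Z from M'. Working with `lintegral` makes every exchange of
integrals a case of Tonelli. -/
lemma stieltjes_dirichletMeanLaw_succ (hθ : 0 < θ) (hH : ∀ᵐ x ∂H, 0 ≤ x)
    (hlog : Integrable (fun x => Real.log (1 + x)) H) {z : ℝ} (hz : 0 < z) :
    ∫ m, (1 + z * m) ^ (-(θ + 1)) ∂(dirichletMeanLaw θ H) =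
      (∫ x, (1 + z * x)⁻¹ ∂H) * ∫ m, (1 + z * m) ^ (-θ) ∂(dirichletMeanLaw θ H) := by
  have := isProbabilityMeasureBeta one_pos hθ
  have := isProbabilityMeasure_dirichletMeanLaw (H := H) hθ hH
  have hρ := dirichletMeanLaw_ae_nonneg (H := H) hθ hH
  set ρ := dirichletMeanLaw θ H with hρdef
  have hnn : ∀ {μ : Measure ℝ} (p : ℝ), (∀ᵐ m ∂μ, 0 ≤ m) →
      0 ≤ᵐ[μ] fun m => (1 + z * m) ^ (-p) := by
    intro μ p h
    filter_upwards [h] with m hm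
    exact Real.rpow_nonneg (by positivity) _
  have hnn' : 0 ≤ᵐ[H] fun m => (1 + z * m)⁻¹ := by
    filter_upwards [hH] with m hm
    simp only [Pi.zero_apply]
    positivity
  rw [integral_eq_lintegral_of_nonneg_ae (hnn _ hρ)
      (Measurable.aestronglyMeasurable (by fun_prop)),
    integral_eq_lintegral_of_nonneg_ae hnn'
      (Measurable.aestronglyMeasurable (by fun_prop)),
    integral_eq_lintegral_of_nonneg_ae (hnn _ hρ)
      (Measurable.aestronglyMeasurable (by fun_prop)), ← ENNReal.toReal_mul]
  congr 1
  rw [hρdef, lintegral_dirichletMeanLaw hθ hH hlog (by fun_prop), ← hρdef,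
    lintegral_prod_symm _ (by fun_prop), ← lintegral_mul_const _ (by fun_prop)]
  refine lintegral_congr_ae ?_
  filter_upwards [hH] with x hx
  rw [lintegral_lintegral_swap (by fun_prop), ← lintegral_const_mul _ (by fun_prop)]
  refine lintegral_congr_ae ?_
  filter_upwards [hρ] with m hm
  have h1 : 0 < 1 + z * x := by positivity
  have h2 : 0 < 1 + z * m := by positivity
  rw [← ENNReal.ofReal_mul (by positivity), ← lintegral_betaMeasure_one hθ h1 h2]
  refine lintegral_congr fun v => ?_
  congr 2
  ring

/-- The Markov-Krein (Cifarelli-Regazzini) identity for Dirichlet means. -/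
lemma stieltjes_dirichletMeanLaw (hθ : 0 < θ) (hH : ∀ᵐ x ∂H, 0 ≤ x)
    (hlog : Integrable (fun x => Real.log (1 + x)) H) {z : ℝ} (hz : 0 < z) :
    ∫ m, (1 + z * m) ^ (-θ) ∂(dirichletMeanLaw θ H) =
      Real.exp (-θ * ∫ x, Real.log (1 + z * x) ∂H) := by
  have := isProbabilityMeasure_dirichletMeanLaw (H := H) hθ hH
  have hρ := dirichletMeanLaw_ae_nonneg (H := H) hθ hH
  set T : ℝ → ℝ := fun z => ∫ m, (1 + z * m) ^ (-θ) ∂(dirichletMeanLaw θ H) with hT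
  set φ : ℝ → ℝ := fun z => ∫ x, Real.log (1 + z * x) ∂H with hφ
  -- The recursion says T' = -θφ'T, so T·exp(θφ) is constant on (0, ∞); its limit at 0+ is 1.
  have hderiv : ∀ w ∈ Ioi (0 : ℝ), HasDerivAt (fun w => T w * Real.exp (θ * φ w)) 0 w := by
    intro w hw
    have h1 := hasDerivAt_stieltjes hρ (mem_Ioi.1 hw) hθ
    have h2 := hasDerivAt_integral_log hH hlog (mem_Ioi.1 hw)
    rw [stieltjes_dirichletMeanLaw_succ hθ hH hlog hw] at h1
    refine (h1.mul (h2.const_mul θ).exp).congr_deriv ?_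
    have : w ≠ 0 := (mem_Ioi.1 hw).ne'
    field_simp
    ring
  have hconst : ∀ w ∈ Ioi (0 : ℝ), T w * Real.exp (θ * φ w) = T z * Real.exp (θ * φ z) :=
    fun w hw => isOpen_Ioi.is_const_of_deriv_eq_zero isPreconnected_Ioi
      (fun w hw => (hderiv w hw).differentiableAt.differentiableWithinAt)
      (fun w hw => (hderiv w hw).deriv) hw hz
  have hlim : Filter.Tendsto (fun w => T w * Real.exp (θ * φ w)) (nhdsWithin 0 (Ioi 0))
      (nhds (1 * Real.exp (θ * 0))) :=
    (tendsto_stieltjes_zero hρ hθ).mul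
      ((Real.continuous_exp.tendsto _).comp ((tendsto_integral_log_zero hH hlog).const_mul θ))
  have hlim' : Filter.Tendsto (fun w => T w * Real.exp (θ * φ w)) (nhdsWithin 0 (Ioi 0))
      (nhds (T z * Real.exp (θ * φ z))) :=
    tendsto_const_nhds.congr' (by
      filter_upwards [self_mem_nhdsWithin] with w hw using (hconst w hw).symm)
  have heq := tendsto_nhds_unique hlim' hlim
  rw [mul_zero, Real.exp_zero, mul_one] at heq
  rw [neg_mul, Real.exp_neg]
  exact eq_inv_of_mul_eq_one_left heq

end MarkovKrein

/-! ### The map x ↦ cx/(cx+1) and its effect on laws. -/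

lemma measurable_ratio (c : ℝ) : Measurable fun x : ℝ => c * x / (c * x + 1) := by fun_prop

lemma ratio_mem_Icc {c x : ℝ} (hc : 0 < c) (hx : 0 ≤ x) :
    c * x / (c * x + 1) ∈ Icc (0 : ℝ) 1 :=
  ⟨by positivity, by rw [div_le_one (by positivity)]; linarith⟩

/-- The algebra behind both halves of the result: under logarithms it transforms the Thorin measure,
under powers the law of the mean. -/
lemma one_add_mul_ratio {c x : ℝ} (hc : 0 < c) (hx : 0 ≤ x) (z : ℝ) :
    1 + z * (c * x / (c * x + 1)) = (1 + (1 + z) * c * x) / (1 + c * x) := by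
  have : 0 < c * x + 1 := by positivity
  have : 0 < 1 + c * x := by positivity
  field_simp
  ring

lemma one_sub_ratio {c x : ℝ} (hc : 0 < c) (hx : 0 ≤ x) :
    1 - c * x / (c * x + 1) = (1 + c * x)⁻¹ := by
  have : 0 < c * x + 1 := by positivity
  have : 0 < 1 + c * x := by positivity
  field_simp
  ring

lemma ratio_div_one_sub {c x : ℝ} (hc : 0 < c) (hx : 0 ≤ x) :
    c * x / (c * x + 1) / (c * (1 - c * x / (c * x + 1))) = x := by
  rw [one_sub_ratio hc hx]
  have : 0 < 1 + c * x := by positivity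
  field_simp
  ring

lemma image_ratio_Ioi {c : ℝ} (hc : 0 < c) :
    (fun x : ℝ => c * x / (c * x + 1)) '' Ioi 0 = Ioo 0 1 := by
  ext y
  constructor
  · rintro ⟨x, hx, rfl⟩
    have hx' : 0 < x := hx
    exact ⟨by positivity, by rw [div_lt_one (by positivity)]; linarith⟩
  · rintro ⟨h0, h1⟩
    have h2 : 0 < 1 - y := sub_pos.2 h1
    refine ⟨y / (c * (1 - y)), div_pos h0 (mul_pos hc h2), ?_⟩
    simp only
    have : c * (y / (c * (1 - y))) = y / (1 - y) := by field_simp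
    rw [this]
    field_simp
    ring

/-- Change of variables along `x ↦ c x / (c x + 1)`. -/
lemma setLIntegral_Ioo_ratio {c : ℝ} (hc : 0 < c) (G : ℝ → ENNReal) :
    ∫⁻ y in Ioo (0 : ℝ) 1, G y =
      ∫⁻ x in Ioi (0 : ℝ), ENNReal.ofReal (c / (1 + c * x) ^ 2) * G (c * x / (c * x + 1)) := by
  have hd : ∀ x ∈ Ioi (0 : ℝ), HasDerivWithinAt (fun x : ℝ => c * x / (c * x + 1))
      (c / (1 + c * x) ^ 2) (Ioi 0) x := by
    intro x hx
    have hx' : 0 < x := hx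
    have h1 : HasDerivAt (fun x : ℝ => c * x) c x := by
      simpa using (hasDerivAt_id x).const_mul c
    have h2 : c * x + 1 ≠ 0 := by positivity
    refine ((h1.div (h1.add_const 1) h2).congr_deriv ?_).hasDerivWithinAt
    rw [add_comm 1]
    congr 1
    ring
  have hinj : InjOn (fun x : ℝ => c * x / (c * x + 1)) (Ioi 0) := by
    intro x hx y hy hxy
    simp only at hxy
    rw [← ratio_div_one_sub hc (le_of_lt hx), hxy, ratio_div_one_sub hc (le_of_lt hy)]
  rw [← image_ratio_Ioi hc, lintegral_image_eq_lintegral_abs_deriv_mul measurableSet_Ioi hd hinj]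
  refine setLIntegral_congr_fun measurableSet_Ioi fun x hx => ?_
  have hx' : 0 < x := hx
  rw [abs_of_pos (by positivity)]

section RatioLaw

variable {θ c : ℝ} {H : Measure ℝ}

lemma ratioLaw_ae_mem_Icc (hc : 0 < c) (hH : ∀ᵐ x ∂H, 0 ≤ x) :
    ∀ᵐ y ∂(ratioLaw c H), y ∈ Icc (0 : ℝ) 1 :=
  (ae_map_iff (measurable_ratio c).aemeasurable measurableSet_Icc).2
    (hH.mono fun _ hx => ratio_mem_Icc hc hx)

variable [IsProbabilityMeasure H]

instance isProbabilityMeasure_ratioLaw : IsProbabilityMeasure (ratioLaw c H) :=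
  Measure.isProbabilityMeasure_map (measurable_ratio c).aemeasurable

lemma integrable_log_ratioLaw (hc : 0 < c) (hH : ∀ᵐ x ∂H, 0 ≤ x) {z : ℝ} (hz : 0 ≤ z) :
    Integrable (fun y => Real.log (1 + z * y)) (ratioLaw c H) := by
  refine Integrable.of_bound (Measurable.aestronglyMeasurable (by fun_prop)) (Real.log (1 + z)) ?_
  filter_upwards [ratioLaw_ae_mem_Icc hc hH] with y hy
  have := mul_nonneg hz hy.1
  rw [Real.norm_eq_abs, abs_of_nonneg (Real.log_nonneg (by linarith))]
  exact Real.log_le_log (by positivity) (by nlinarith [hy.2])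

lemma integral_log_ratioLaw (hc : 0 < c) (hH : ∀ᵐ x ∂H, 0 ≤ x)
    (hlog : Integrable (fun x => Real.log (1 + x)) H) {z : ℝ} (hz : 0 ≤ z) :
    ∫ y, Real.log (1 + z * y) ∂(ratioLaw c H) =
      ∫ x, Real.log (1 + (1 + z) * c * x) ∂H - ∫ x, Real.log (1 + c * x) ∂H := by
  rw [ratioLaw, integral_map (measurable_ratio c).aemeasurable
    (Measurable.aestronglyMeasurable (by fun_prop)),
    ← integral_sub (integrable_log_one_add_mul hH hlog (by positivity))
      (integrable_log_one_add_mul hH hlog hc.le)]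
  refine integral_congr_ae ?_
  filter_upwards [hH] with x hx
  rw [one_add_mul_ratio hc hx, Real.log_div (by positivity) (by positivity)]

lemma stieltjesMean_eq (hθ : 0 < θ) (hc : 0 < c) (hH : ∀ᵐ x ∂H, 0 ≤ x)
    (hlog : Integrable (fun x => Real.log (1 + x)) H) :
    stieltjesMean θ c H = Real.exp (-θ * ∫ x, Real.log (1 + c * x) ∂H) :=
  stieltjes_dirichletMeanLaw hθ hH hlog hc

/-- The law of `M_θ(Q_c)` is the image of the law of `M_θ(H)`, weighted by
`m ↦ (1 + c m) ^ (-θ)`, under `m ↦ c m / (c m + 1)`. -/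
lemma dirichletMeanLaw_ratioLaw (hθ : 0 < θ) (hc : 0 < c) (hH : ∀ᵐ x ∂H, 0 ≤ x)
    (hlog : Integrable (fun x => Real.log (1 + x)) H) :
    dirichletMeanLaw θ (ratioLaw c H) =
      ((dirichletMeanLaw θ H).withDensity fun m =>
        ENNReal.ofReal ((1 + c * m) ^ (-θ) / stieltjesMean θ c H)).map
          fun m => c * m / (c * m + 1) := by
  have hQ := ratioLaw_ae_mem_Icc hc hH
  have hQ0 : ∀ᵐ x ∂(ratioLaw c H), 0 ≤ x := hQ.mono fun x hx => hx.1
  have hQlog : Integrable (fun x => Real.log (1 + x)) (ratioLaw c H) := by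
    simpa using integrable_log_ratioLaw hc hH (z := 1) zero_le_one
  have := isProbabilityMeasure_dirichletMeanLaw (H := H) hθ hH
  have := isProbabilityMeasure_dirichletMeanLaw (H := ratioLaw c H) hθ hQ0
  have hρ := dirichletMeanLaw_ae_nonneg (H := H) hθ hH
  have hK : 0 < stieltjesMean θ c H := by
    rw [stieltjesMean_eq hθ hc hH hlog]; exact Real.exp_pos _
  have hwm : Measurable fun m : ℝ => ENNReal.ofReal ((1 + c * m) ^ (-θ) / stieltjesMean θ c H) := by
    fun_prop
  have hw0 : ∀ᵐ m ∂(dirichletMeanLaw θ H), 0 ≤ (1 + c * m) ^ (-θ) / stieltjesMean θ c H := by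
    filter_upwards [hρ] with m hm
    have := Real.rpow_nonneg (by positivity : 0 ≤ 1 + c * m) (-θ)
    positivity
  have hprob : IsProbabilityMeasure ((dirichletMeanLaw θ H).withDensity fun m =>
      ENNReal.ofReal ((1 + c * m) ^ (-θ) / stieltjesMean θ c H)) := by
    refine ⟨?_⟩
    rw [withDensity_apply _ .univ, Measure.restrict_univ, ← ofReal_integral_eq_lintegral_ofReal
      ((integrable_one_add_mul_rpow_neg hρ hc.le hθ.le).div_const _) hw0, integral_div]
    change ENNReal.ofReal (stieltjesMean θ c H / stieltjesMean θ c H) = 1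
    rw [div_self hK.ne', ENNReal.ofReal_one]
  have := Measure.isProbabilityMeasure_map (μ := (dirichletMeanLaw θ H).withDensity fun m =>
      ENNReal.ofReal ((1 + c * m) ^ (-θ) / stieltjesMean θ c H)) (measurable_ratio c).aemeasurable
  -- At z, both transforms equal that of the mean of H at (1+z)c divided by its value at c.
  refine ext_of_stieltjes hθ (dirichletMeanLaw_ae_le_one hθ hQ) ?_ fun z hz => ?_
  · refine (ae_map_iff (measurable_ratio c).aemeasurable measurableSet_Icc).2 ?_
    exact (withDensity_absolutelyContinuous _ _).ae_le
      (hρ.mono fun m hm => ratio_mem_Icc hc hm)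
  · rw [stieltjes_dirichletMeanLaw hθ hQ0 hQlog hz, integral_log_ratioLaw hc hH hlog hz.le,
      integral_map (measurable_ratio c).aemeasurable
        (Measurable.aestronglyMeasurable (by fun_prop)),
      integral_withDensity_eq_integral_toReal_smul hwm (by simp)]
    have h1 : ∫ m, (1 + (1 + z) * c * m) ^ (-θ) / stieltjesMean θ c H ∂(dirichletMeanLaw θ H) =
        ∫ m, (ENNReal.ofReal ((1 + c * m) ^ (-θ) / stieltjesMean θ c H)).toReal •
          (1 + z * (c * m / (c * m + 1))) ^ (-θ) ∂(dirichletMeanLaw θ H) := by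
      refine integral_congr_ae ?_
      filter_upwards [hρ, hw0] with m hm hwm
      have h2 : 0 < 1 + c * m := by positivity
      have h3 : (1 + c * m) ^ (-θ) ≠ 0 := (Real.rpow_pos_of_pos h2 _).ne'
      rw [ENNReal.toReal_ofReal hwm, smul_eq_mul, one_add_mul_ratio hc hm,
        Real.div_rpow (by positivity) h2.le]
      field_simp
    rw [← h1, integral_div, stieltjes_dirichletMeanLaw hθ hH hlog (by positivity),
      stieltjesMean_eq hθ hc hH hlog, ← Real.exp_sub]
    congr 1
    ring

end RatioLaw

/-! ### Densities of the two means. -/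

lemma lintegral_eq_setLIntegral_of_hasDensity {ρ : Measure ℝ} {f : ℝ → ℝ} (hf : HasDensity ρ f)
    {S : Set ℝ} (hS : MeasurableSet S) (hρ : ∀ᵐ x ∂ρ, x ∈ S) {g : ℝ → ENNReal}
    (hg : Measurable g) :
    ∫⁻ x, g x ∂ρ = ∫⁻ x in S, ENNReal.ofReal (f x) * g x := by
  rw [← Measure.restrict_eq_self_of_ae_mem hρ, hf.eq_withDensity, restrict_withDensity hS,
    lintegral_withDensity_eq_lintegral_mul _ hf.measurable.ennreal_ofReal hg]
  rfl

lemma hasDensity_indicator {ρ : Measure ℝ} {k : ℝ → ℝ} {S : Set ℝ} (hS : MeasurableSet S)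
    (hk : Measurable k) (hk0 : ∀ x ∈ S, 0 ≤ k x)
    (h : ∀ s, MeasurableSet s →
      ∫⁻ x, s.indicator 1 x ∂ρ = ∫⁻ x in S, s.indicator 1 x * ENNReal.ofReal (k x)) :
    HasDensity ρ (S.indicator k) where
  measurable := hk.indicator hS
  nonneg := indicator_nonneg hk0
  eq_withDensity := by
    ext s hs
    rw [← lintegral_indicator_one hs, h s hs, withDensity_apply _ hs, ← lintegral_indicator hs,
      ← lintegral_indicator hS]
    refine lintegral_congr fun x => ?_
    by_cases h1 : x ∈ s <;> by_cases h2 : x ∈ S <;> simp [h1, h2]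

/-- Removes the endpoints 0 and 1, which the change of variables between open intervals does not
see. -/
lemma HasDensity.ae_ne {ρ : Measure ℝ} {f : ℝ → ℝ} (hf : HasDensity ρ f) (a : ℝ) :
    ∀ᵐ x ∂ρ, x ≠ a := by
  rw [hf.eq_withDensity]
  exact (withDensity_absolutelyContinuous _ _).ae_le
    (compl_mem_ae_iff.2 (measure_singleton a))

section Densities

variable {θ c : ℝ} {H : Measure ℝ} [IsProbabilityMeasure H]

lemma lintegral_dirichletMeanLaw_ratioLaw (hθ : 0 < θ) (hc : 0 < c) (hH : ∀ᵐ x ∂H, 0 ≤ x)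
    (hlog : Integrable (fun x => Real.log (1 + x)) H) {F : ℝ → ENNReal} (hF : Measurable F) :
    ∫⁻ y, F y ∂(dirichletMeanLaw θ (ratioLaw c H)) =
      ∫⁻ m, ENNReal.ofReal ((1 + c * m) ^ (-θ) / stieltjesMean θ c H) *
        F (c * m / (c * m + 1)) ∂(dirichletMeanLaw θ H) := by
  rw [dirichletMeanLaw_ratioLaw hθ hc hH hlog, lintegral_map hF (measurable_ratio c),
    lintegral_withDensity_eq_lintegral_mul _ (by fun_prop) (by fun_prop)]
  rfl

lemma hasDensity_ratioLaw (hθ : 0 < θ) (hc : 0 < c) (hH : ∀ᵐ x ∂H, 0 ≤ x)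
    (hlog : Integrable (fun x => Real.log (1 + x)) H) {f : ℝ → ℝ}
    (hf : HasDensity (dirichletMeanLaw θ H) f) :
    HasDensity (dirichletMeanLaw θ (ratioLaw c H))
      ((Ioo (0 : ℝ) 1).indicator fun y =>
        (1 - y) ^ (θ - 2) / (c * stieltjesMean θ c H) * f (y / (c * (1 - y)))) := by
  have hK : 0 < stieltjesMean θ c H := by
    rw [stieltjesMean_eq hθ hc hH hlog]; exact Real.exp_pos _
  have hpos : ∀ᵐ m ∂(dirichletMeanLaw θ H), m ∈ Ioi (0 : ℝ) := by
    filter_upwards [dirichletMeanLaw_ae_nonneg (H := H) hθ hH, hf.ae_ne 0] with m h1 h2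
    exact lt_of_le_of_ne h1 h2.symm
  have hfm := hf.measurable
  refine hasDensity_indicator measurableSet_Ioo ?_ ?_ fun s hs => ?_
  · exact Measurable.mul (by fun_prop) (hfm.comp (by fun_prop))
  · intro y hy
    have := Real.rpow_nonneg (sub_pos.2 hy.2).le (θ - 2)
    have := hf.nonneg (y / (c * (1 - y)))
    positivity
  · have hsm : Measurable (s.indicator (1 : ℝ → ENNReal)) := measurable_one.indicator hs
    have hGm : Measurable fun m : ℝ =>
        ENNReal.ofReal ((1 + c * m) ^ (-θ) / stieltjesMean θ c H) *
          s.indicator (1 : ℝ → ENNReal) (c * m / (c * m + 1)) :=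
      Measurable.mul (by fun_prop) (hsm.comp (measurable_ratio c))
    rw [lintegral_dirichletMeanLaw_ratioLaw hθ hc hH hlog hsm,
      lintegral_eq_setLIntegral_of_hasDensity hf measurableSet_Ioi hpos
        hGm,
      setLIntegral_Ioo_ratio hc]
    refine setLIntegral_congr_fun measurableSet_Ioi fun x hx => ?_
    have hx' : 0 < x := hx
    have h1 : 0 < 1 + c * x := by positivity
    have hfx := hf.nonneg x
    have h2 := Real.rpow_pos_of_pos h1 (-θ)
    rw [ratio_div_one_sub hc hx'.le, one_sub_ratio hc hx'.le]
    -- As 1 - y = (1+cx)⁻¹, the Jacobian c/(1+cx)² accounts for the shift of the exponent from θ to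
    -- θ-2 and for the factor c.
    have h3 : ENNReal.ofReal (f x) * ENNReal.ofReal ((1 + c * x) ^ (-θ) / stieltjesMean θ c H) =
        ENNReal.ofReal (c / (1 + c * x) ^ 2) * ENNReal.ofReal
          ((1 + c * x)⁻¹ ^ (θ - 2) / (c * stieltjesMean θ c H) * f x) := by
      rw [← ENNReal.ofReal_mul hfx, ← ENNReal.ofReal_mul (by positivity)]
      congr 1
      rw [Real.inv_rpow h1.le, ← Real.rpow_neg h1.le, show -(θ - 2) = -θ + (2 : ℕ) by push_cast; ring,
        Real.rpow_add_natCast h1.ne']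
      field_simp
    rw [← mul_assoc, h3]
    ring

lemma hasDensity_of_ratioLaw (hθ : 0 < θ) (hc : 0 < c) (hH : ∀ᵐ x ∂H, 0 ≤ x)
    (hlog : Integrable (fun x => Real.log (1 + x)) H) {g : ℝ → ℝ}
    (hg : HasDensity (dirichletMeanLaw θ (ratioLaw c H)) g) :
    HasDensity (dirichletMeanLaw θ H)
      ((Ioi (0 : ℝ)).indicator fun x =>
        c * (1 + c * x) ^ (θ - 2) * g (c * x / (1 + c * x)) * stieltjesMean θ c H) := by
  have hK : 0 < stieltjesMean θ c H := by
    rw [stieltjesMean_eq hθ hc hH hlog]; exact Real.exp_pos _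
  have hρ := dirichletMeanLaw_ae_nonneg (H := H) hθ hH
  have hpos : ∀ᵐ y ∂(dirichletMeanLaw θ (ratioLaw c H)), y ∈ Ioo (0 : ℝ) 1 := by
    filter_upwards [dirichletMeanLaw_ae_le_one hθ (ratioLaw_ae_mem_Icc hc hH), hg.ae_ne 0,
      hg.ae_ne 1] with m h1 h2 h3
    exact ⟨lt_of_le_of_ne h1.1 h2.symm, lt_of_le_of_ne h1.2 h3⟩
  have hgm := hg.measurable
  refine hasDensity_indicator measurableSet_Ioi ?_ ?_ fun s hs => ?_
  · exact (Measurable.mul (by fun_prop) (hgm.comp (by fun_prop))).mul_const _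
  · intro x hx
    have hx' : 0 < x := hx
    have h1 : 0 < 1 + c * x := by positivity
    have := Real.rpow_nonneg h1.le (θ - 2)
    have := hg.nonneg (c * x / (1 + c * x))
    positivity
  · have hsm : Measurable (s.indicator (1 : ℝ → ENNReal)) := measurable_one.indicator hs
    have hGm : Measurable fun y : ℝ => s.indicator (1 : ℝ → ENNReal) (y / (c * (1 - y))) *
        ENNReal.ofReal (stieltjesMean θ c H * (1 - y) ^ (-θ)) :=
      (hsm.comp (by fun_prop)).mul (by fun_prop)
    -- The weight is positive, hence invertible: integrating its reciprocal K(1-y)^(-θ), K the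
    -- normalizing constant, against the law of M_θ(Q_c) recovers the law of M_θ(H).
    have h0 : ∫⁻ m, s.indicator 1 m ∂(dirichletMeanLaw θ H) =
        ∫⁻ y, s.indicator (1 : ℝ → ENNReal) (y / (c * (1 - y))) *
          ENNReal.ofReal (stieltjesMean θ c H * (1 - y) ^ (-θ))
          ∂(dirichletMeanLaw θ (ratioLaw c H)) := by
      rw [lintegral_dirichletMeanLaw_ratioLaw hθ hc hH hlog hGm]
      refine lintegral_congr_ae ?_
      filter_upwards [hρ] with m hm
      have h1 : 0 < 1 + c * m := by positivity
      have h2 := Real.rpow_pos_of_pos h1 (-θ)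
      rw [ratio_div_one_sub hc hm, one_sub_ratio hc hm, mul_left_comm,
        ← ENNReal.ofReal_mul (by positivity), Real.inv_rpow h1.le]
      rw [show (1 + c * m) ^ (-θ) / stieltjesMean θ c H *
        (stieltjesMean θ c H * ((1 + c * m) ^ (-θ))⁻¹) = 1 by field_simp]
      simp
    rw [h0, lintegral_eq_setLIntegral_of_hasDensity hg measurableSet_Ioo hpos hGm,
      setLIntegral_Ioo_ratio hc]
    refine setLIntegral_congr_fun measurableSet_Ioi fun x hx => ?_
    have hx' : 0 < x := hx
    have h1 : 0 < 1 + c * x := by positivity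
    have hgx := hg.nonneg (c * x / (c * x + 1))
    have h2 := Real.rpow_pos_of_pos h1 θ
    rw [ratio_div_one_sub hc hx'.le, one_sub_ratio hc hx'.le, 
      mul_left_comm (ENNReal.ofReal (g _)),
      mul_left_comm (ENNReal.ofReal (c / _)), ← ENNReal.ofReal_mul hgx,
      ← ENNReal.ofReal_mul (by positivity), add_comm 1 (c * x)]
    congr 2
    rw [add_comm (c * x) 1, Real.inv_rpow h1.le, Real.rpow_neg h1.le, inv_inv,
      show θ - 2 = θ - (2 : ℕ) by push_cast; ring, Real.rpow_sub_natCast h1.ne']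
    field_simp

end Densities

/-! ### Exponential tilting. -/

section Tilt

variable {c : ℝ} {μ : Measure ℝ}

/-- With both parameters equal to c the weight is exp(-w), which shifts l to 1+l; scaling by c then
multiplies the argument. -/
lemma integral_exp_expTilt (hc : 0 < c) (l : ℝ) :
    ∫ x, Real.exp (-l * x) ∂(expTilt c c μ) =
      (∫ x, Real.exp (-((1 + l) * c) * x) ∂μ) / ∫ x, Real.exp (-c * x) ∂μ := by
  have hm : Measurable fun x : ℝ => c * x := by fun_prop
  rw [expTilt, integral_tilted, integral_map hm.aemeasurable (by fun_prop),
    integral_map hm.aemeasurable (by fun_prop), ← integral_div]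
  congr 1
  ext x
  rw [div_self hc.ne', smul_eq_mul, div_mul_eq_mul_div, ← Real.exp_add]
  ring_nf

lemma expTilt_ae {p : ℝ → Prop} (hp : MeasurableSet {x | p x}) (h : ∀ᵐ x ∂μ, p (c * x)) :
    ∀ᵐ x ∂(expTilt c c μ), p x := by
  have hm : Measurable fun x : ℝ => c * x := by fun_prop
  exact (tilted_absolutelyContinuous _ _).ae_le ((ae_map_iff hm.aemeasurable hp).2 h)

variable [IsProbabilityMeasure μ]

lemma isProbabilityMeasure_expTilt (hc : 0 < c) (hμ : ∀ᵐ x ∂μ, 0 ≤ x) :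
    IsProbabilityMeasure (expTilt c c μ) := by
  have hm : Measurable fun x : ℝ => c * x := by fun_prop
  have := Measure.isProbabilityMeasure_map (μ := μ) hm.aemeasurable
  refine isProbabilityMeasure_tilted (Integrable.of_bound (by fun_prop) 1 ?_)
  refine (ae_map_iff hm.aemeasurable (measurableSet_le (by fun_prop) measurable_const)).2 ?_
  filter_upwards [hμ] with x hx
  rw [Real.norm_eq_abs, abs_of_pos (Real.exp_pos _), Real.exp_le_one_iff, div_self hc.ne']
  nlinarith [mul_nonneg hc.le hx]

lemma integral_exp_map_sum_pi (n : ℕ) (l : ℝ) :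
    ∫ x, Real.exp (-l * x) ∂((Measure.pi fun _ : Fin n => μ).map fun x => ∑ i, x i) =
      (∫ x, Real.exp (-l * x) ∂μ) ^ n := by
  have hm : Measurable fun x : Fin n → ℝ => ∑ i, x i := by fun_prop
  rw [integral_map hm.aemeasurable (by fun_prop)]
  simp_rw [Finset.mul_sum, Real.exp_sum]
  rw [integral_fintype_prod_eq_pow (fun x : ℝ => Real.exp (-l * x)), Fintype.card_fin]

/-- The exponential weight is multiplicative over sums, so tilting an n-fold convolution amounts to
tilting each factor. -/
lemma InfDivisible.expTilt (hc : 0 < c) (hμ : ∀ᵐ x ∂μ, 0 ≤ x) (h : InfDivisible μ) :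
    InfDivisible (expTilt c c μ) := by
  intro n hn
  obtain ⟨ρ, hρ, hsum⟩ := h n hn
  have hm : Measurable fun x : Fin n → ℝ => ∑ i, x i := by fun_prop
  -- If all n summands are negative, so is the sum; hence ρ(-∞, 0)^n ≤ μ(-∞, 0) = 0. This makes the
  -- weight bounded under ρ, so its tilt is a probability measure.
  have hρ0 : ∀ᵐ x ∂ρ, 0 ≤ x := by
    have h1 : ρ (Iio 0) ^ n = 0 := by
      have h2 : (Measure.pi fun _ : Fin n => ρ) (Set.pi univ fun _ => Iio 0) = ρ (Iio 0) ^ n := by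
        simp [Measure.pi_pi]
      have h3 : μ (Iio 0) = 0 := by
        rw [ae_iff] at hμ
        convert hμ using 2
        ext; simp
      rw [← h2, ← nonpos_iff_eq_zero, ← h3, ← hsum, Measure.map_apply hm measurableSet_Iio]
      refine measure_mono fun x hx => ?_
      have : Nonempty (Fin n) := ⟨⟨0, hn⟩⟩
      exact Finset.sum_neg (fun i _ => mem_Iio.1 (hx i (mem_univ i))) Finset.univ_nonempty
    rw [ae_iff]
    convert pow_eq_zero_iff hn.ne' |>.1 h1 using 2
    ext; simp
  have hρ' := isProbabilityMeasure_expTilt hc hρ0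
  have := isProbabilityMeasure_expTilt hc hμ
  refine ⟨_, hρ', ?_⟩
  have := Measure.isProbabilityMeasure_map
    (μ := Measure.pi fun _ : Fin n => _root_.expTilt c c ρ) hm.aemeasurable
  refine ext_of_laplace ?_ ?_ fun l _ => ?_
  · refine (ae_map_iff hm.aemeasurable measurableSet_Ici).2 ?_
    have h1 : ∀ i : Fin n, ∀ᵐ x ∂(Measure.pi fun _ : Fin n => _root_.expTilt c c ρ), 0 ≤ x i :=
      fun i => (measurePreserving_eval (fun _ : Fin n => _root_.expTilt c c ρ)
        i).quasiMeasurePreserving.ae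
        (expTilt_ae measurableSet_Ici (hρ0.mono fun x hx => mul_nonneg hc.le hx))
    filter_upwards [ae_all_iff.2 h1] with x hx
    exact Finset.sum_nonneg fun i _ => hx i
  · exact expTilt_ae measurableSet_Ici (hμ.mono fun x hx => mul_nonneg hc.le hx)
  · rw [integral_exp_map_sum_pi, integral_exp_expTilt hc, integral_exp_expTilt hc, ← hsum,
      integral_exp_map_sum_pi, integral_exp_map_sum_pi, div_pow]

end Tilt

lemma IsGGC.ae_nonneg {θ : ℝ} {ν μ : Measure ℝ} (h : IsGGC θ ν μ) : ∀ᵐ x ∂μ, 0 ≤ x := by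
  rw [ae_iff]
  exact measure_mono_null (fun x hx => (not_le.1 hx).le) h.pos

lemma IsGGC.thorin_ae_nonneg {θ : ℝ} {ν μ : Measure ℝ} (h : IsGGC θ ν μ) : ∀ᵐ x ∂ν, 0 ≤ x := by
  rw [ae_iff]
  exact measure_mono_null (fun x hx => not_le.1 hx) h.thorin_nonneg

lemma IsGGC.integrable_log_one_add {θ : ℝ} {ν μ : Measure ℝ} (h : IsGGC θ ν μ) :
    Integrable (fun x => Real.log (1 + x)) ν := by
  simpa using h.integrable_log 1 one_pos

lemma isGGC_expTilt {θ c : ℝ} (hc : 0 < c) {H μ : Measure ℝ} [IsProbabilityMeasure H]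
    (h : IsGGC θ H μ) : IsGGC θ (ratioLaw c H) (expTilt c c μ) := by
  have := h.isProbabilityMeasure
  have hμ := h.ae_nonneg
  have hH := h.thorin_ae_nonneg
  have hlog := h.integrable_log_one_add
  refine ⟨isProbabilityMeasure_expTilt hc hμ, ?_, h.infDivisible.expTilt hc hμ, inferInstance, ?_,
    fun l hl => integrable_log_ratioLaw hc hH hl.le, fun l hl => ?_⟩
  · have h1 : ∀ᵐ x ∂μ, 0 < x := by
      rw [ae_iff]; exact measure_mono_null (fun x hx => not_lt.1 hx) h.pos
    have h2 : ∀ᵐ x ∂(expTilt c c μ), 0 < x :=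
      expTilt_ae measurableSet_Ioi (h1.mono fun x hx => mul_pos hc hx)
    rw [ae_iff] at h2
    exact measure_mono_null (fun x hx => not_lt.2 hx) h2
  · have h1 := ratioLaw_ae_mem_Icc hc hH
    rw [ae_iff] at h1
    exact measure_mono_null (fun x (hx : x < 0) (h2 : x ∈ Icc (0 : ℝ) 1) => not_le.2 hx h2.1) h1
  · rw [integral_exp_expTilt hc, h.laplace _ (by positivity), h.laplace c hc, ← Real.exp_sub,
      integral_log_ratioLaw hc hH hlog hl.le]
    congr 1
    ring

/-- A plain image-measure computation, (cr+1)/(cr) being the reciprocal of the ratio; r = 0 maps to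
y = 0, so the excluded points match. -/
lemma setIntegral_exp_ratioLaw {c : ℝ} (hc : 0 < c) {H : Measure ℝ} (hH : ∀ᵐ x ∂H, 0 ≤ x)
    (s : ℝ) :
    ∫ r in Ioi (0 : ℝ), Real.exp (-s * ((c * r + 1) / (c * r))) ∂H =
      ∫ y in Ioi (0 : ℝ), Real.exp (-s / y) ∂(ratioLaw c H) := by
  rw [← integral_indicator measurableSet_Ioi, ← integral_indicator measurableSet_Ioi, ratioLaw,
    integral_map (measurable_ratio c).aemeasurable
      ((Measurable.indicator (by fun_prop) measurableSet_Ioi).aestronglyMeasurable)]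
  refine integral_congr_ae ?_
  filter_upwards [hH] with r hr
  rcases eq_or_lt_of_le hr with h | h
  · simp [← h]
  · have h1 : c * r / (c * r + 1) ∈ Ioi (0 : ℝ) := by
      have : 0 < c * r / (c * r + 1) := by positivity
      exact this
    rw [indicator_of_mem (mem_Ioi.2 h), indicator_of_mem h1, div_div_eq_mul_div, mul_div_assoc]

/-! ### The Lévy measure via Frullani integrals. -/

section Levy

lemma measurable_expNegDiv : Measurable fun p : ℝ × ℝ => expNegDiv p.1 p.2 :=
  Measurable.ite (measurableSet_lt measurable_const measurable_snd) (by fun_prop) measurable_const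

lemma expNegDiv_nonneg (s a : ℝ) : 0 ≤ expNegDiv s a := by
  unfold expNegDiv; split_ifs <;> positivity

lemma expNegDiv_le_one {s : ℝ} (hs : 0 < s) (a : ℝ) : expNegDiv s a ≤ 1 := by
  unfold expNegDiv
  split_ifs with h
  · rw [Real.exp_le_one_iff]
    exact div_nonpos_of_nonpos_of_nonneg (by linarith) h.le
  · exact zero_le_one

/-- For a law on [0, 1] this bounds the Lévy density by θ s⁻¹ e^(-s), which makes min(1, s)
integrable. -/
lemma expNegDiv_le_exp_neg {s a : ℝ} (hs : 0 < s) (ha : a ≤ 1) : expNegDiv s a ≤ Real.exp (-s) := by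
  unfold expNegDiv
  split_ifs with h
  · rw [Real.exp_le_exp, div_le_iff₀ h]
    nlinarith
  · positivity

/-- A Frullani integral. -/
lemma lintegral_frullani {l y : ℝ} (hl : 0 < l) (hy : 0 ≤ y) :
    ∫⁻ s in Ioi (0 : ℝ), ENNReal.ofReal (s⁻¹ * expNegDiv s y * (1 - Real.exp (-l * s))) =
      ENNReal.ofReal (Real.log (1 + l * y)) := by
  rcases eq_or_lt_of_le hy with rfl | hy
  · simp [expNegDiv]
  -- The integrand is the integral of exp(-(u+1/y)s) over u in (0, l]; after exchanging, the
  -- s-integral is 1/(u+1/y), whose primitive is a logarithm.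
  have h1 : ∀ s ∈ Ioi (0 : ℝ),
      ENNReal.ofReal (s⁻¹ * expNegDiv s y * (1 - Real.exp (-l * s))) =
        ∫⁻ u in Ioc 0 l, ENNReal.ofReal (Real.exp (-(u + y⁻¹) * s)) := by
    intro s hs
    have hs' : 0 < s := hs
    have hd : ∀ u ∈ uIcc 0 l, HasDerivAt (fun u => -s⁻¹ * Real.exp (-(u + y⁻¹) * s))
        (Real.exp (-(u + y⁻¹) * s)) u := by
      intro u _
      have h2 : HasDerivAt (fun u : ℝ => -(u + y⁻¹) * s) (-1 * s) u :=
        (((hasDerivAt_id u).add_const y⁻¹).neg).mul_const s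
      refine (h2.exp.const_mul (-s⁻¹)).congr_deriv ?_
      field_simp
    have hcont : Continuous fun u : ℝ => Real.exp (-(u + y⁻¹) * s) := by fun_prop
    rw [← ofReal_integral_eq_lintegral_ofReal
      (hcont.integrableOn_Icc.mono_set Ioc_subset_Icc_self) (ae_of_all _ fun u => (Real.exp_pos _).le),
      ← intervalIntegral.integral_of_le hl.le,
      intervalIntegral.integral_eq_sub_of_hasDerivAt hd (hcont.intervalIntegrable _ _)]
    congr 1
    rw [expNegDiv, if_pos hy, show -(l + y⁻¹) * s = -s / y + -l * s by ring,
      show -(0 + y⁻¹) * s = -s / y by ring, Real.exp_add]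
    ring
  rw [setLIntegral_congr_fun measurableSet_Ioi h1, lintegral_lintegral_swap (by fun_prop)]
  have h2 : ∀ u ∈ Ioc 0 l, ∫⁻ s in Ioi (0 : ℝ), ENNReal.ofReal (Real.exp (-(u + y⁻¹) * s)) =
      ENNReal.ofReal (u + y⁻¹)⁻¹ := by
    intro u hu
    have hu' : 0 < u := hu.1
    have hneg : -(u + y⁻¹) < 0 := neg_lt_zero.2 (by positivity)
    rw [← ofReal_integral_eq_lintegral_ofReal (integrableOn_exp_mul_Ioi hneg 0)
      (ae_of_all _ fun s => (Real.exp_pos _).le), integral_exp_mul_Ioi hneg]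
    congr 1
    rw [mul_zero, Real.exp_zero, neg_div_neg_eq, one_div]
  rw [setLIntegral_congr_fun measurableSet_Ioc h2]
  have hy' : 0 < y⁻¹ := inv_pos.2 hy
  have hd : ∀ u ∈ uIcc 0 l, HasDerivAt (fun u => Real.log (u + y⁻¹)) (u + y⁻¹)⁻¹ u := by
    intro u hu
    rw [uIcc_of_le hl.le] at hu
    have : u + y⁻¹ ≠ 0 := (add_pos_of_nonneg_of_pos hu.1 hy').ne'
    exact (((hasDerivAt_id u).add_const y⁻¹).log this).congr_deriv (by simp)
  have hcont : ContinuousOn (fun u : ℝ => (u + y⁻¹)⁻¹) (Icc 0 l) :=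
    ContinuousOn.inv₀ (by fun_prop) fun u hu => (add_pos_of_nonneg_of_pos hu.1 hy').ne'
  rw [← ofReal_integral_eq_lintegral_ofReal
      (hcont.integrableOn_Icc.mono_set Ioc_subset_Icc_self),
    ← intervalIntegral.integral_of_le hl.le,
    intervalIntegral.integral_eq_sub_of_hasDerivAt hd
      (ContinuousOn.intervalIntegrable (by rwa [uIcc_of_le hl.le])),
    ← Real.log_div (by positivity) (by positivity)]
  · congr 2
    field_simp
    ring
  · refine ae_restrict_of_forall_mem measurableSet_Ioc fun u hu => ?_
    exact inv_nonneg.2 (add_pos_of_nonneg_of_pos hu.1.le hy').le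

/-- The Lévy measure of GGC`(θ, Q)`. -/
noncomputable def thorinLevyMeasure (θ : ℝ) (Q : Measure ℝ) : Measure ℝ :=
  (volume.restrict (Ioi (0 : ℝ))).withDensity fun s =>
    ENNReal.ofReal (θ * s⁻¹ * ∫ y, expNegDiv s y ∂Q)

lemma thorinLevyMeasure_Iic (θ : ℝ) (Q : Measure ℝ) : thorinLevyMeasure θ Q (Iic 0) = 0 := by
  refine withDensity_absolutelyContinuous _ _ ?_
  rw [Measure.restrict_apply measurableSet_Iic, Iic_inter_Ioi, Ioc_self, measure_empty]

variable {θ : ℝ} {Q : Measure ℝ} [IsProbabilityMeasure Q]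

/-- Moves the expectation out of the density so that Tonelli applies; for s > 0 its integrand lies
in [0, 1], so both notions of integral agree. -/
lemma lintegral_thorinLevyMeasure (hθ : 0 < θ) {F : ℝ → ENNReal} (hF : Measurable F) :
    ∫⁻ s, F s ∂(thorinLevyMeasure θ Q) =
      ∫⁻ s in Ioi (0 : ℝ), ∫⁻ y, ENNReal.ofReal (θ * s⁻¹ * expNegDiv s y) * F s ∂Q := by
  have hm : Measurable fun p : ℝ × ℝ => ENNReal.ofReal (θ * p.1⁻¹ * expNegDiv p.1 p.2) :=
    ((by fun_prop : Measurable fun p : ℝ × ℝ => θ * p.1⁻¹).mul measurable_expNegDiv).ennreal_ofReal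
  have hD : (fun s : ℝ => ENNReal.ofReal (θ * s⁻¹ * ∫ y, expNegDiv s y ∂Q)) =ᵐ[volume.restrict
      (Ioi (0 : ℝ))] fun s => ∫⁻ y, ENNReal.ofReal (θ * s⁻¹ * expNegDiv s y) ∂Q := by
    refine ae_restrict_of_forall_mem measurableSet_Ioi fun s hs => ?_
    have hs' : 0 < s := hs
    have hi : Integrable (fun y => expNegDiv s y) Q := by
      refine Integrable.of_bound
        (measurable_expNegDiv.comp measurable_prodMk_left).aestronglyMeasurable 1 ?_
      filter_upwards with y
      rw [Real.norm_eq_abs, abs_of_nonneg (expNegDiv_nonneg s y)]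
      exact expNegDiv_le_one hs' y
    simp only
    rw [← integral_const_mul, ofReal_integral_eq_lintegral_ofReal (hi.const_mul _)]
    filter_upwards with y
    have := expNegDiv_nonneg s y
    simp only [Pi.zero_apply]
    positivity
  rw [thorinLevyMeasure, withDensity_congr_ae hD,
    lintegral_withDensity_eq_lintegral_mul _ hm.lintegral_prod_right' hF]
  refine lintegral_congr fun s => ?_
  rw [Pi.mul_apply, ← lintegral_mul_const (F s) (f := fun y => ENNReal.ofReal (θ * s⁻¹ * expNegDiv s y))
    (hm.comp measurable_prodMk_left)]

lemma lintegral_min_thorinLevyMeasure (hθ : 0 < θ) (hQ : ∀ᵐ y ∂Q, y ∈ Icc (0 : ℝ) 1) :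
    ∫⁻ s, ENNReal.ofReal (min 1 s) ∂(thorinLevyMeasure θ Q) < ⊤ := by
  rw [lintegral_thorinLevyMeasure hθ (by fun_prop)]
  have hle : ∀ s ∈ Ioi (0 : ℝ),
      ∫⁻ y, ENNReal.ofReal (θ * s⁻¹ * expNegDiv s y) * ENNReal.ofReal (min 1 s) ∂Q ≤
        ENNReal.ofReal (θ * Real.exp (-1 * s)) := by
    intro s hs
    have hs' : 0 < s := hs
    calc ∫⁻ y, ENNReal.ofReal (θ * s⁻¹ * expNegDiv s y) * ENNReal.ofReal (min 1 s) ∂Q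
        ≤ ∫⁻ _, ENNReal.ofReal (θ * Real.exp (-1 * s)) ∂Q := by
          refine lintegral_mono_ae ?_
          filter_upwards [hQ] with y hy
          have h0 := expNegDiv_nonneg s y
          rw [← ENNReal.ofReal_mul (by positivity)]
          refine ENNReal.ofReal_le_ofReal ?_
          calc θ * s⁻¹ * expNegDiv s y * min 1 s ≤ θ * s⁻¹ * Real.exp (-s) * s := by
                gcongr
                · exact expNegDiv_le_exp_neg hs' hy.2
                · exact min_le_right _ _
            _ = θ * Real.exp (-1 * s) := by
                rw [neg_one_mul]; field_simp
      _ = _ := by simp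
  refine (setLIntegral_mono' measurableSet_Ioi hle).trans_lt ?_
  have hint : IntegrableOn (fun s : ℝ => θ * Real.exp (-1 * s)) (Ioi 0) :=
    (integrableOn_exp_mul_Ioi (by norm_num) 0).const_mul θ
  rw [← ofReal_integral_eq_lintegral_ofReal hint (ae_of_all _ fun s => by positivity)]
  exact ENNReal.ofReal_lt_top

lemma integral_thorinLevyMeasure (hθ : 0 < θ) (hQ : ∀ᵐ y ∂Q, 0 ≤ y) {l : ℝ} (hl : 0 < l) :
    ∫ s, (1 - Real.exp (-l * s)) ∂(thorinLevyMeasure θ Q) =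
      θ * ∫ y, Real.log (1 + l * y) ∂Q := by
  have hpos : ∀ᵐ s ∂(thorinLevyMeasure θ Q), 0 < s := by
    rw [ae_iff]
    exact measure_mono_null (fun s hs => not_lt.1 hs) (thorinLevyMeasure_Iic θ Q)
  rw [integral_eq_lintegral_of_nonneg_ae _ (Measurable.aestronglyMeasurable (by fun_prop)),
    lintegral_thorinLevyMeasure hθ (by fun_prop), lintegral_lintegral_swap,
    integral_eq_lintegral_of_nonneg_ae _ (Measurable.aestronglyMeasurable (by fun_prop)),
    ← ENNReal.toReal_ofReal hθ.le, ← ENNReal.toReal_mul, ENNReal.toReal_ofReal hθ.le,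
    ← lintegral_const_mul _ (by fun_prop)]
  · congr 1
    refine lintegral_congr_ae ?_
    filter_upwards [hQ] with y hy
    rw [← lintegral_frullani hl hy, ← lintegral_const_mul]
    · refine setLIntegral_congr_fun measurableSet_Ioi fun s hs => ?_
      have hs' : 0 < s := hs
      have h0 := expNegDiv_nonneg s y
      rw [← ENNReal.ofReal_mul (by positivity), ← ENNReal.ofReal_mul hθ.le]
      congr 1
      ring
    · exact (((by fun_prop : Measurable fun s : ℝ => s⁻¹).mul
        (measurable_expNegDiv.comp measurable_prodMk_right)).mul (by fun_prop)).ennreal_ofReal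
  · filter_upwards [hQ] with y hy
    exact Real.log_nonneg (by nlinarith [mul_nonneg hl.le hy])
  · have hm : Measurable fun p : ℝ × ℝ => ENNReal.ofReal (θ * p.1⁻¹ * expNegDiv p.1 p.2) :=
      ((by fun_prop : Measurable fun p : ℝ × ℝ => θ * p.1⁻¹).mul
        measurable_expNegDiv).ennreal_ofReal
    exact (hm.mul (by fun_prop)).aemeasurable
  · filter_upwards [hpos] with s hs
    simp only [Pi.zero_apply, sub_nonneg, Real.exp_le_one_iff]
    nlinarith

lemma IsGGC.hasDriftLevyMeasure {μ : Measure ℝ} (hθ : 0 < θ) (h : IsGGC θ Q μ)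
    (hQ : ∀ᵐ y ∂Q, y ∈ Icc (0 : ℝ) 1) : HasDriftLevyMeasure μ 0 (thorinLevyMeasure θ Q) where
  drift_nonneg := le_rfl
  levy_nonpos := thorinLevyMeasure_Iic _ _
  levy_min := lintegral_min_thorinLevyMeasure hθ hQ
  laplace l hl := by
    rw [h.laplace l hl, integral_thorinLevyMeasure hθ h.thorin_ae_nonneg hl, zero_mul, zero_add,
      neg_mul]

end Levy

/-! ### Assembly. -/

theorem proposition3p2
    {θ c : ℝ} (hθ : 0 < θ) (hc : 0 < c)
    (H : Measure ℝ) [IsProbabilityMeasure H]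
    (μ : Measure ℝ) (hμ : IsGGC θ H μ)
    {Ω : Type*} [MeasurableSpace Ω] (P : Measure Ω) [IsProbabilityMeasure P]
    (X A : Ω → ℝ) (hX : HasLaw X H P) (hA : ∀ ω, A ω = c * X ω / (c * X ω + 1)) :
    -- `A` takes values in `[0, 1]` and has law `Q_c`
    (∀ᵐ ω ∂P, A ω ∈ Icc (0 : ℝ) 1) ∧
    HasLaw A (ratioLaw c H) P ∧
    -- the `(c, c)`-tilt of GGC`(θ, H)` is GGC`(θ, Q_c)`
    IsGGC θ (ratioLaw c H) (expTilt c c μ) ∧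
    -- `Q_c` is the Thorin measure `H^(c,c)`
    (∀ s : ℝ, 0 < s →
      ∫ r in Ioi (0 : ℝ), Real.exp (-s * ((c * r + 1) / (c * r))) ∂H =
        ∫ y in Ioi (0 : ℝ), Real.exp (-s / y) ∂(ratioLaw c H)) ∧
    -- the tilt has no drift and Lévy density `θ s⁻¹ E[exp (-s / A)]`
    HasDriftLevyMeasure (expTilt c c μ) 0
      ((volume.restrict (Ioi (0 : ℝ))).withDensity fun s =>
        ENNReal.ofReal (θ * s⁻¹ * ∫ ω, expNegDiv s (A ω) ∂P)) ∧
    -- the mean functionals `M_θ(H)` and `M_θ(Q_c)` are well defined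
    (∀ᵐ ω ∂(dirichletBase θ H), Integrable (fun x => x) (randomAtoms ω)) ∧
    (∀ᵐ ω ∂(dirichletBase θ (ratioLaw c H)), Integrable (fun x => x) (randomAtoms ω)) ∧
    -- densities: from `M_θ(H)` to `M_θ(Q_c)`
    (∀ f : ℝ → ℝ, HasDensity (dirichletMeanLaw θ H) f →
      HasDensity (dirichletMeanLaw θ (ratioLaw c H))
        ((Ioo (0 : ℝ) 1).indicator fun y =>
          (1 - y) ^ (θ - 2) / (c * stieltjesMean θ c H) * f (y / (c * (1 - y))))) ∧
    -- densities: from `M_θ(Q_c)` to `M_θ(H)`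
    (∀ g : ℝ → ℝ, HasDensity (dirichletMeanLaw θ (ratioLaw c H)) g →
      HasDensity (dirichletMeanLaw θ H)
        ((Ioi (0 : ℝ)).indicator fun x =>
          c * (1 + c * x) ^ (θ - 2) * g (c * x / (1 + c * x)) * stieltjesMean θ c H)) ∧
    -- the last formula for `c = 1`
    (∀ g : ℝ → ℝ, HasDensity (dirichletMeanLaw θ (ratioLaw 1 H)) g →
      HasDensity (dirichletMeanLaw θ H)
        ((Ioi (0 : ℝ)).indicator fun x =>
          (1 + x) ^ (θ - 2) * g (x / (1 + x)) * stieltjesMean θ 1 H)) := by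
  have hH := hμ.thorin_ae_nonneg
  have hlog := hμ.integrable_log_one_add
  have hQ := ratioLaw_ae_mem_Icc hc hH
  have hAX : A = (fun x => c * x / (c * x + 1)) ∘ X := funext hA
  have hAlaw : HasLaw A (ratioLaw c H) P := by
    refine ⟨hAX ▸ (measurable_ratio c).comp_aemeasurable hX.aemeasurable, ?_⟩
    rw [hAX, ← AEMeasurable.map_map_of_aemeasurable (measurable_ratio c).aemeasurable
      hX.aemeasurable, hX.map_eq, ratioLaw]
  have hGGC := isGGC_expTilt hc hμ
  -- The expectation over Ω depends on A only through its law Q_c.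
  have hlevy : (volume.restrict (Ioi (0 : ℝ))).withDensity (fun s =>
      ENNReal.ofReal (θ * s⁻¹ * ∫ ω, expNegDiv s (A ω) ∂P)) =
      thorinLevyMeasure θ (ratioLaw c H) := by
    unfold thorinLevyMeasure
    congr! 5 with s
    rw [← hAlaw.map_eq, integral_map hAlaw.aemeasurable (f := expNegDiv s)
      (measurable_expNegDiv.comp measurable_prodMk_left).aestronglyMeasurable]
  refine ⟨?_, hAlaw, hGGC, fun s _ => setIntegral_exp_ratioLaw hc hH s, ?_,
    ae_integrable_randomAtoms hθ hH hlog,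
    ae_integrable_randomAtoms hθ (hQ.mono fun x hx => hx.1) hGGC.integrable_log_one_add,
    fun f hf => hasDensity_ratioLaw hθ hc hH hlog hf,
    fun g hg => hasDensity_of_ratioLaw hθ hc hH hlog hg, fun g hg => ?_⟩
  · rw [← hAlaw.map_eq] at hQ
    exact ae_of_ae_map hAlaw.aemeasurable hQ
  · rw [hlevy]
    exact hGGC.hasDriftLevyMeasure hθ hQ
  · simpa using hasDensity_of_ratioLaw hθ one_pos hH hlog hg
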